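/- \textbf{Setting.} Fix $p$ and let $X_1,\dots,X_p$ be discrete variables, $X_i$ having $r_i=d_i+1$ levels $1,\dots,r_i$, encoded by the vector $\mathbf x_i\in\{0,1\}^{d_i}$ of indicators of the levels $2,\dots,r_i$. A parameter $\phi$ consists of groups $\beta_{j\cdot i}=(\beta_{j1i},\dots,\beta_{jr_ji})\in\mathbb R^{d_ir_j}$ ($1\le i,j\le p$) and intercepts $\beta_{j\cdot 0}\in\mathbb R^{r_j}$; $\|\cdot\|_2$ is the Euclidean norm. The graph $\mathcal G_\phi$ on $\{1,\dots,p\}$ has the edge $i\to j$ iff $\beta_{j\cdot i}\neq 0$, and $\phi$ is acyclic if $\mathcal G_\phi$ is. Let $$\Omega=\Big\{\phi:\ \phi \text{ acyclic},\ \beta_{j10}=0 \text{ and } \sum_{m=1}^{r_j}\beta_{jmi}=0 \text{ for all } i,j\Big\}.$$ For $x=(x_1,\dots,x_p)$ with dummy vectors $\mathbf x_1,\dots,\mathbf x_p$, put $$p(x\mid\phi)=\prod_{j=1}^p\frac{\exp(\beta_{jx_j0}+\sum_i\mathbf x_i^T\beta_{jx_ji})}{\sum_{m=1}^{r_j}\exp(\beta_{jm0}+\sum_i\mathbf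 x_i^T\beta_{jmi})}$$ (the multi-logit model), and let $\phi_{[k]}$ be $\phi$ with $\beta_{k\cdot i}$ replaced by $0$ for all $i$. Call $\phi\in\Omega$ \emph{natural} if, whenever there is a directed path from $i$ to $j$ in $\mathcal G_\phi$, the variables $X_i$ and $X_j$ are not independent under $p(\cdot\mid\phi_{[i]})$. For each $n$ the data are $n$ independent rows $\mathcal X_1,\dots,\mathcal X_n$, split into $p$ blocks with index sets $\mathcal I_1,\dots,\mathcal I_p$ of sizes $n_1,\dots,n_p$; the rows in $\mathcal I_k$ have distribution $p(\cdot\mid\phi^*_{[k]})$, where the true parameter $\phi^*\in\Omega$ is fixed and natural. For $\lambda_n>0$ and weights $\tau_{ji}$ let $$R(\phi)=\sum_{k=1}^p\sum_{h\in\mathcal I_k}\log p(\mathcal X_h\mid\phi_{[k]})-\lambda_n\sum_{j=1}^p\sum_{i=1}^p\tau_{ji}\|\beta_{j\cdot i}\|_2 .$$ \textbf{Theorem.} Let $\gamma>0$, let $\tilde\beta_{j\cdot i}$ be estimates with $\|\tilde\beta_{j\cdot i}-\beta^*_{j\cdot i}\|_2=O_p(n^{-1/2})$ for all $i,j\in\{1,\dots,p\}$,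 and let $\tau_{ji}=\min(\|\tilde\beta_{j\cdot i}\|_2^{-\gamma},\|\tilde\beta_{i\cdot j}\|_2^{-\gamma})$, with the conventions $0^{-\gamma}=\infty$ and $\infty\cdot 0=0$. If $\lambda_n/\sqrt n\to0$, $\lambda_nn^{(\gamma-1)/2}\to\infty$ and $n_k/n\to\alpha_k>0$ for $k=1,\dots,p$, then there are random parameters $\hat\phi=\hat\phi_n$ with $\|\hat\phi-\phi^*\|_2=O_p(n^{-1/2})$ such that, with probability tending to one, $\hat\phi\in\Omega$ is a global maximizer of $R$ over $\Omega$ and $\hat\beta_{j\cdot i}=0$ for all $(j,i)$ with $\beta^*_{j\cdot i}=0$. -/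

import Mathlib

open MeasureTheory ProbabilityTheory Filter Topology
open scoped ENNReal

noncomputable section

namespace DiscreteBN

/-! Discrete Bayesian networks on the nodes `Fin p`. The variable `X i` has `d i + 1` levels
(level `1` of the text is `0 : Fin (d i + 1)`) and is encoded by `d i` dummy variables. -/

variable {p : ℕ} {d : Fin p → ℕ}

/-- A joint configuration of the `p` discrete variables (one row of the data matrix). -/
abbrev Config (d : Fin p → ℕ) : Type := ∀ i : Fin p, Fin (d i + 1)

/-- The index set of all scalar parameters: the coefficient `β_{jℓi,a}` (weight of the `a`-th dummy
variable of `X i` in the score of level `ℓ` of `X j`) is indexed by `Sum.inl ⟨j, i, ℓ, a⟩`, and the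
intercept `β_{jℓ0}` by `Sum.inr ⟨j, ℓ⟩`. -/
abbrev ParamIdx (d : Fin p → ℕ) : Type :=
  (Σ j : Fin p, Σ i : Fin p, Fin (d j + 1) × Fin (d i)) ⊕ (Σ j : Fin p, Fin (d j + 1))

/-- The Euclidean space of all parameter vectors `φ`. -/
abbrev Param (d : Fin p → ℕ) : Type := EuclideanSpace ℝ (ParamIdx d)

/-- The Euclidean space in which the group `β_{j·i}` lives; its dimension is `r_j d_i`. -/
abbrev Group (d : Fin p → ℕ) (j i : Fin p) : Type :=
  EuclideanSpace ℝ (Fin (d j + 1) × Fin (d i))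

/-- The component group `β_{j·i}` of `φ`: the influence of `X i` on `X j`. -/
def group (φ : Param d) (j i : Fin p) : Group d j i :=
  WithLp.toLp 2 fun a => φ (Sum.inl ⟨j, i, a⟩)

/-- The intercept `β_{jℓ0}` of `φ`. -/
def intercept (φ : Param d) (j : Fin p) (l : Fin (d j + 1)) : ℝ := φ (Sum.inr ⟨j, l⟩)

/-- The graph induced by `φ`: there is an edge `i → j` iff the group `β_{j·i}` is non-zero. -/
def Edge (φ : Param d) (i j : Fin p) : Prop := group φ j i ≠ 0

/-- `X i` is an ancestor of `X j` in the graph induced by `φ`: there is a directed path (with at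
least one edge) from `i` to `j`. -/
def Ancestor (φ : Param d) (i j : Fin p) : Prop := Relation.TransGen (Edge φ) i j

/-- The graph induced by `φ` has no directed cycle (in particular, no loop). -/
def Acyclic (φ : Param d) : Prop := ∀ i, ¬ Ancestor φ i i

/-- The parameter space: acyclic `φ` with `β_{j10} = 0` for all `j` and
`∑ m, β_{jmi} = 0` for all `i, j`. -/
def paramSpace (d : Fin p → ℕ) : Set (Param d) :=
  {φ | Acyclic φ ∧ (∀ j, intercept φ j 0 = 0) ∧
    ∀ j i, ∀ a : Fin (d i), ∑ m : Fin (d j + 1), group φ j i (m, a) = 0}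

/-- The dummy variables of a level of `X i`: the `a`-th one indicates level `a + 1`, and the first
level is the reference level. -/
def dummy {k : ℕ} (l : Fin (k + 1)) (a : Fin k) : ℝ := if l = a.succ then 1 else 0

/-- The score `x_hᵀ β_{jℓ·}` of level `ℓ` of `X j` given the configuration `x`. -/
def score (φ : Param d) (j : Fin p) (l : Fin (d j + 1)) (x : Config d) : ℝ :=
  intercept φ j l + ∑ i : Fin p, ∑ a : Fin (d i), dummy (x i) a * group φ j i (l, a)

/-- The multi-logit conditional probability that `X j = ℓ` given the other variables. -/
def condProb (φ : Param d) (j : Fin p) (l : Fin (d j + 1)) (x : Config d) : ℝ :=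
  Real.exp (score φ j l x) / ∑ m : Fin (d j + 1), Real.exp (score φ j m x)

/-- The joint probability mass function `p(x | φ)`, factorized along the graph of `φ`. -/
def pmf (φ : Param d) (x : Config d) : ℝ := ∏ j : Fin p, condProb φ j (x j) x

/-- The joint distribution with probability mass function `p(x | φ)`. -/
def jointLaw (φ : Param d) : Measure (Config d) :=
  ∑ x : Config d, ENNReal.ofReal (pmf φ x) • Measure.dirac x

/-- `φ_[k]`: all groups `β_{k·i}` are set to zero, i.e. all edges pointing to `k` are deleted. -/
def cut (k : Fin p) (φ : Param d) : Param d :=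
  WithLp.toLp 2 fun idx =>
    match idx with
    | Sum.inl q => if q.1 = k then 0 else φ (Sum.inl q)
    | Sum.inr q => φ (Sum.inr q)

/-- `φ` is natural: whenever `X i` is an ancestor of `X j`, the variables `X i` and `X j` are
dependent under the joint distribution given by `φ_[i]`. -/
def Natural (φ : Param d) : Prop :=
  ∀ i j : Fin p, Ancestor φ i j →
    ¬ IndepFun (fun x : Config d => x i) (fun x : Config d => x j) (jointLaw (cut i φ))

/-- The `n` rows of a data matrix `X` whose row `h` belongs to block `blk h` (the variable
`X (blk h)` is under intervention there): the rows are independent, and those of block `k` have the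
distribution `p(· | φ_[k])`. -/
structure IsInterventionalSample {S : Type*} [MeasurableSpace S] (P : Measure S) (φ : Param d)
    {n : ℕ} (blk : Fin n → Fin p) (X : Fin n → S → Config d) : Prop where
  measurable : ∀ h, Measurable (X h)
  indep : iIndepFun X P
  law : ∀ h, HasLaw (X h) (jointLaw (cut (blk h) φ)) P

/-- The size `n_k` of the `k`-th block. -/
def blockSize {n : ℕ} (blk : Fin n → Fin p) (k : Fin p) : ℕ :=
  (Finset.univ.filter fun h => blk h = k).card

/-- The log-likelihood `L(φ) = ∑ k, ∑ h ∈ I_k, log p(x_h | φ_[k])` of a data matrix `x`. -/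
def logLik {n : ℕ} (blk : Fin n → Fin p) (x : Fin n → Config d) (φ : Param d) : ℝ :=
  ∑ k : Fin p, ∑ h ∈ Finset.univ.filter (fun h => blk h = k), Real.log (pmf (cut k φ) (x h))

/-- The adaptive weight `min (‖β̃_{j·i}‖^{-γ}, ‖β̃_{i·j}‖^{-γ})` as an extended real:
the inverse power of `0` is `∞`. -/
def adaptiveWeight (γ : ℝ) (ψ : ∀ j i : Fin p, Group d j i) (j i : Fin p) : ℝ≥0∞ :=
  min (‖ψ j i‖ₑ ^ (-γ)) (‖ψ i j‖ₑ ^ (-γ))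

/-- The penalized log-likelihood `R(φ) = L(φ) - lam * ∑ τ_{ji} ‖β_{j·i}‖`. An infinite weight
times a zero group is `0`; an infinite weight on a non-zero group makes `R` equal to `-∞`. -/
def penLogLik {n : ℕ} (blk : Fin n → Fin p) (x : Fin n → Config d) (lam : ℝ)
    (τ : Fin p → Fin p → ℝ≥0∞) (φ : Param d) : EReal :=
  (logLik blk x φ : EReal) -
    ((ENNReal.ofReal lam * ∑ j : Fin p, ∑ i : Fin p, τ j i * ‖group φ j i‖ₑ : ℝ≥0∞) : EReal)

/-- `Z n = O_p(a n)`: for every `ε > 0` there is a constant `C` such that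
`P (|Z n| > C a n) ≤ ε` for all large `n`. -/
def IsBigOp {S : Type*} [MeasurableSpace S] (P : Measure S) (Z : ℕ → S → ℝ) (a : ℕ → ℝ) : Prop :=
  ∀ ε : ℝ, 0 < ε → ∃ C : ℝ, 0 < C ∧
    ∀ᶠ n in atTop, P {ω | C * a n < |Z n ω|} ≤ ENNReal.ofReal ε

end DiscreteBN

end

noncomputable section

namespace DiscreteBN

variable {p : ℕ} {d : Fin p → ℕ}

/-! ### Conditional probabilities and marginals -/

/-! The core is a quantitative identifiability bound, uniform over all acyclic graphs: on bounded
parts of the parameter space, `‖φ - φs‖` is at most a constant times the distance `pmfDist φ φs` of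
the interventional distributions (`exists_norm_sub_le_pmfDist`). If `φ` keeps every ancestral
relation of `φs`, the ancestors of a node `j` in `φ` contain the parents of `j` under both
parameters. Both conditional laws of `X j` are then ratios of marginals over the same sets of nodes,
and score contrasts recover the coefficients linearly. If `φ` loses a relation from `i` to `j`, then
`X i` and `X j` are independent under `φ_[i]` but dependent under `φs_[i]` by naturality, so the
distance is bounded below.

A Hellinger-type inequality turns this into quadratic growth of the summed Kullback-Leibler
divergences (`exists_sq_norm_le_sum_klCut`). All randomness enters through finitely many cell counts
and the initial estimates; on the event `Accurate`, made likely by Chebyshev's inequality and a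
union bound, the argument is deterministic. The likelihood confines near-optimal parameters to a
ball, so a maximizer exists. An expected loss of order `n ‖φ - φs‖²` against fluctuations and a
penalty gain of order `√n ‖φ - φs‖` gives the rate for every maximizer
(`exists_eventually_consistent`).

For sparsity (`eventually_sparse`), a maximizer is compared with its restriction to the groups
present in `φs`. Near `φs` the graph of the maximizer contains that of `φs`, so the divergence has
zero derivative at `φs` in the direction of the difference, and the superfluous groups raise the
likelihood by at most order `√n` times their norm. Acyclicity also excludes the reversed edge from
`φs`, so both initial estimates in the weight are of order `n^(-1/2)` and the penalty dominates. -/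

lemma group_apply (φ : Param d) (j i : Fin p) (q : Fin (d j + 1) × Fin (d i)) :
    group φ j i q = φ (Sum.inl ⟨j, i, q⟩) := rfl

lemma sum_exp_score_pos (φ : Param d) (j : Fin p) (x : Config d) :
    0 < ∑ m : Fin (d j + 1), Real.exp (score φ j m x) :=
  Finset.sum_pos (fun _ _ => Real.exp_pos _) Finset.univ_nonempty

lemma condProb_pos (φ : Param d) (j : Fin p) (l : Fin (d j + 1)) (x : Config d) :
    0 < condProb φ j l x :=
  div_pos (Real.exp_pos _) (sum_exp_score_pos φ j x)

lemma sum_condProb (φ : Param d) (j : Fin p) (x : Config d) :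
    ∑ l, condProb φ j l x = 1 := by
  simp only [condProb, ← Finset.sum_div]
  exact div_self (sum_exp_score_pos φ j x).ne'

lemma condProb_le_one (φ : Param d) (j : Fin p) (l : Fin (d j + 1)) (x : Config d) :
    condProb φ j l x ≤ 1 := by
  rw [← sum_condProb φ j x]
  exact Finset.single_le_sum (f := fun l => condProb φ j l x)
    (fun l _ => (condProb_pos φ j l x).le) (Finset.mem_univ l)

lemma pmf_pos (φ : Param d) (x : Config d) : 0 < pmf φ x :=
  Finset.prod_pos fun _ _ => condProb_pos _ _ _ _

lemma pmf_le_one (φ : Param d) (x : Config d) : pmf φ x ≤ 1 :=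
  Finset.prod_le_one (fun _ _ => (condProb_pos _ _ _ _).le) fun _ _ => condProb_le_one _ _ _ _

lemma pmf_le_condProb (φ : Param d) (x : Config d) (j : Fin p) :
    pmf φ x ≤ condProb φ j (x j) x := by
  unfold pmf
  rw [← Finset.mul_prod_erase _ _ (Finset.mem_univ j)]
  exact mul_le_of_le_one_right (condProb_pos _ _ _ _).le
    (Finset.prod_le_one (fun _ _ => (condProb_pos _ _ _ _).le) fun _ _ => condProb_le_one _ _ _ _)

lemma score_congr (φ : Param d) (j : Fin p) (l : Fin (d j + 1)) {x y : Config d}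
    (h : ∀ i, Edge φ i j → x i = y i) : score φ j l x = score φ j l y := by
  unfold score
  congr 1
  refine Finset.sum_congr rfl fun i _ => ?_
  by_cases hi : group φ j i = 0
  · simp [hi]
  · rw [h i hi]

lemma condProb_congr (φ : Param d) (j : Fin p) (l : Fin (d j + 1)) {x y : Config d}
    (h : ∀ i, Edge φ i j → x i = y i) : condProb φ j l x = condProb φ j l y := by
  unfold condProb
  simp only [score_congr φ j _ h]

/-- A set of nodes that contains the parents of each of its members. -/
def AncClosed (φ : Param d) (A : Finset (Fin p)) : Prop :=
  ∀ i j, Edge φ i j → j ∈ A → i ∈ A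

/-- The probability that the configuration agrees with `x` on `A`. -/
def marginal (φ : Param d) (A : Finset (Fin p)) (x : Config d) : ℝ :=
  ∑ y ∈ Finset.univ.filter (fun y : Config d => ∀ i ∈ A, y i = x i), pmf φ y

lemma exists_source_notMem {φ : Param d} (hac : Acyclic φ) {A : Finset (Fin p)}
    (h : ∃ j, j ∉ A) : ∃ j, j ∉ A ∧ ∀ i, Edge φ i j → i ∈ A := by
  have : IsTrans (Fin p) (Ancestor φ) := ⟨fun _ _ _ h1 h2 => Relation.TransGen.trans h1 h2⟩
  have : Std.Irrefl (Ancestor φ) := ⟨hac⟩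
  have wf : WellFounded (Ancestor φ) := Finite.wellFounded_of_trans_of_irrefl _
  obtain ⟨j, hj, hmin⟩ := wf.has_min {j | j ∉ A} h
  refine ⟨j, hj, fun i hi => ?_⟩
  by_contra hiA
  exact hmin i hiA (Relation.TransGen.single hi)

/-- Induction on the size of the complement of `A`: a node outside `A` with all its parents in `A`
can be added, and summing over its levels removes its factor, since conditional probabilities sum to
one and no other factor over `A` involves it. -/
theorem marginal_eq_prod {φ : Param d} (hac : Acyclic φ) (A : Finset (Fin p))
    (hA : AncClosed φ A) (x : Config d) :
    marginal φ A x = ∏ i ∈ A, condProb φ i (x i) x := by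
  induction hn : Aᶜ.card generalizing A x with
  | zero =>
    have : A = Finset.univ := by simpa using hn
    subst this
    have : (Finset.univ.filter (fun y : Config d => ∀ i ∈ Finset.univ, y i = x i)) = {x} := by
      ext y
      simp [funext_iff]
    simp only [marginal, this, Finset.sum_singleton, pmf]
  | succ n ih =>
    have hne : ∃ j, j ∉ A := by
      have : Aᶜ.Nonempty := by
        rw [← Finset.card_pos]
        omega
      obtain ⟨j, hj⟩ := this
      exact ⟨j, by simpa using hj⟩
    obtain ⟨j, hj, hpar⟩ := exists_source_notMem hac hne
    have hA' : AncClosed φ (insert j A) := by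
      intro i k hik hk
      rcases Finset.mem_insert.1 hk with rfl | hk
      · exact Finset.mem_insert_of_mem (hpar i hik)
      · exact Finset.mem_insert_of_mem (hA i k hik hk)
    have hcard : (insert j A)ᶜ.card = n := by
      rw [Finset.card_compl, Finset.card_insert_of_notMem hj]
      rw [Finset.card_compl] at hn
      omega
    have key : marginal φ A x =
        ∑ l : Fin (d j + 1), marginal φ (insert j A) (Function.update x j l) := by
      unfold marginal
      rw [← Finset.sum_fiberwise (s := Finset.univ.filter (fun y : Config d => ∀ i ∈ A, y i = x i))
        (g := fun y : Config d => y j)]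
      refine Finset.sum_congr rfl fun l _ => Finset.sum_congr ?_ fun _ _ => rfl
      ext y
      simp only [Finset.mem_filter, Finset.mem_univ, true_and, Finset.mem_insert, forall_eq_or_imp,
        Function.update_self]
      constructor
      · rintro ⟨h1, h2⟩
        refine ⟨h2, fun i hi => ?_⟩
        rw [Function.update_of_ne (ne_of_mem_of_not_mem hi hj), h1 i hi]
      · rintro ⟨h1, h2⟩
        refine ⟨fun i hi => ?_, h1⟩
        have := h2 i hi
        rwa [Function.update_of_ne (ne_of_mem_of_not_mem hi hj)] at this
    rw [key]
    have hterm : ∀ l : Fin (d j + 1), marginal φ (insert j A) (Function.update x j l) =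
        condProb φ j l x * ∏ i ∈ A, condProb φ i (x i) x := by
      intro l
      rw [ih _ hA' _ hcard, Finset.prod_insert hj, Function.update_self]
      congr 1
      · exact condProb_congr _ _ _ fun i hi =>
          Function.update_of_ne (ne_of_mem_of_not_mem (hpar i hi) hj) _ _
      · refine Finset.prod_congr rfl fun i hi => ?_
        rw [Function.update_of_ne (ne_of_mem_of_not_mem hi hj)]
        exact condProb_congr _ _ _ fun k hk =>
          Function.update_of_ne (ne_of_mem_of_not_mem (hA k i hk hi) hj) _ _
    simp only [hterm, ← Finset.sum_mul, sum_condProb, one_mul]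

theorem sum_pmf {φ : Param d} (hac : Acyclic φ) : ∑ x, pmf φ x = 1 := by
  have := marginal_eq_prod hac ∅ (fun _ _ _ h => by simp at h) (fun _ => 0)
  simpa [marginal] using this

/-! ### Interventions and ancestral sets -/

lemma group_cut (k : Fin p) (φ : Param d) (j i : Fin p) :
    group (cut k φ) j i = if j = k then 0 else group φ j i := by
  ext q
  by_cases h : j = k
  · simp [group, cut, h]
  · simp [group, cut, h]

lemma intercept_cut (k : Fin p) (φ : Param d) (j : Fin p) (l : Fin (d j + 1)) :
    intercept (cut k φ) j l = intercept φ j l := rfl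

lemma Edge.of_cut {k : Fin p} {φ : Param d} {i j : Fin p} (h : Edge (cut k φ) i j) :
    Edge φ i j ∧ j ≠ k := by
  unfold Edge at *
  rw [group_cut] at h
  by_cases hj : j = k
  · simp [hj] at h
  · simpa [hj] using h

lemma Acyclic.mono {φ ψ : Param d} (h : ∀ i j, Edge ψ i j → Edge φ i j) (hφ : Acyclic φ) :
    Acyclic ψ := fun i hi => hφ i (Relation.TransGen.mono h _ _ hi)

lemma Acyclic.cut {φ : Param d} (hφ : Acyclic φ) (k : Fin p) : Acyclic (cut k φ) :=
  hφ.mono fun _ _ h => h.of_cut.1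

lemma AncClosed.cut {φ : Param d} {A : Finset (Fin p)} (hA : AncClosed φ A) (k : Fin p) :
    AncClosed (cut k φ) A := fun i j h hj => hA i j h.of_cut.1 hj

open Classical in
/-- The strict ancestors of a node. -/
def ancestors (φ : Param d) (j : Fin p) : Finset (Fin p) :=
  Finset.univ.filter fun i => Ancestor φ i j

lemma mem_ancestors {φ : Param d} {i j : Fin p} : i ∈ ancestors φ j ↔ Ancestor φ i j := by
  simp [ancestors]

lemma ancClosed_ancestors {φ ψ : Param d} (h : ∀ i j, Edge ψ i j → Ancestor φ i j) (j : Fin p) :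
    AncClosed ψ (ancestors φ j) := fun i k hik hk =>
  mem_ancestors.2 ((h i k hik).trans (mem_ancestors.1 hk))

lemma ancClosed_insert_ancestors {φ ψ : Param d} (h : ∀ i j, Edge ψ i j → Ancestor φ i j)
    (j : Fin p) : AncClosed ψ (insert j (ancestors φ j)) := by
  intro i k hik hk
  refine Finset.mem_insert_of_mem ?_
  rcases Finset.mem_insert.1 hk with rfl | hk
  · exact mem_ancestors.2 (h i k hik)
  · exact ancClosed_ancestors h j i k hik hk

/-- The conditional probability of a node given its ancestors is a ratio of marginals. -/
lemma condProb_mul_marginal {φ ψ : Param d} (hφ : Acyclic φ) (hψ : Acyclic ψ)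
    (h : ∀ i j, Edge ψ i j → Ancestor φ i j) (j : Fin p) (x : Config d) :
    condProb ψ j (x j) x * marginal ψ (ancestors φ j) x =
      marginal ψ (insert j (ancestors φ j)) x := by
  have hj : j ∉ ancestors φ j := fun hj => hφ j (mem_ancestors.1 hj)
  rw [marginal_eq_prod hψ _ (ancClosed_ancestors h j),
    marginal_eq_prod hψ _ (ancClosed_insert_ancestors h j), Finset.prod_insert hj]

/-- After the intervention `i` has no parents, and `i` lies outside the parent-closed set formed by
`j` and its ancestors. Adjoining `i` to that set therefore only multiplies the marginal by a
constant factor, the law of `X i`. -/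
lemma sum_pmf_pair_eq_mul {φ : Param d} (hφ : Acyclic φ) {i j : Fin p} (hij : i ≠ j)
    (hanc : ¬ Ancestor φ i j) (a : Fin (d i + 1)) (b : Fin (d j + 1)) :
    ∑ y ∈ Finset.univ.filter (fun y : Config d => y i = a ∧ y j = b), pmf (cut i φ) y =
      (∑ y ∈ Finset.univ.filter (fun y : Config d => y i = a), pmf (cut i φ) y) *
      ∑ y ∈ Finset.univ.filter (fun y : Config d => y j = b), pmf (cut i φ) y := by
  set q := cut i φ with hq
  have hqac : Acyclic q := hφ.cut i
  set A := insert j (ancestors φ j) with hAdef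
  have hA : AncClosed q A :=
    ancClosed_insert_ancestors (fun _ _ h => Relation.TransGen.single h.of_cut.1) j
  have hiA : i ∉ A := by
    simp [hAdef, mem_ancestors, hij, hanc]
  have hnopar : ∀ k, ¬ Edge q k i := fun k h => h.of_cut.2 rfl
  have hiA' : AncClosed q (insert i A) := by
    intro k m hkm hm
    rcases Finset.mem_insert.1 hm with rfl | hm
    · exact absurd hkm (hnopar k)
    · exact Finset.mem_insert_of_mem (hA k m hkm hm)
  have hi1 : AncClosed q {i} := by
    intro k m hkm hm
    rw [Finset.mem_singleton] at hm
    subst hm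
    exact absurd hkm (hnopar k)
  have hcond : ∀ x y : Config d, condProb q i a x = condProb q i a y :=
    fun x y => condProb_congr _ _ _ fun k hk => absurd hk (hnopar k)
  have hsingle : ∑ y ∈ Finset.univ.filter (fun y : Config d => y i = a), pmf q y =
      condProb q i a (fun _ => 0) := by
    have := marginal_eq_prod hqac {i} hi1 (Function.update (fun _ => 0) i a)
    rw [Finset.prod_singleton, Function.update_self, hcond _ (fun _ => 0)] at this
    rw [← this, marginal]
    simp
  rw [hsingle]
  have hfib : ∀ s : Finset (Config d), ∑ y ∈ s, pmf q y =
      ∑ z : (∀ k : A, Fin (d k + 1)),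
        ∑ y ∈ s with (fun k : A => y k) = z, pmf q y :=
    fun s => (Finset.sum_fiberwise s (fun (y : Config d) (k : A) => y k) _).symm
  rw [hfib, hfib (Finset.univ.filter (fun y : Config d => y j = b)), Finset.mul_sum]
  refine Finset.sum_congr rfl fun z _ => ?_
  have hjA : j ∈ A := Finset.mem_insert_self _ _
  by_cases hz : z ⟨j, hjA⟩ = b
  · let x : Config d := fun k => if hk : k ∈ A then z ⟨k, hk⟩ else 0
    have hx : ∀ k (hk : k ∈ A), x k = z ⟨k, hk⟩ := fun k hk => by simp [x, hk]
    have h1 : ∑ y ∈ (Finset.univ.filter (fun y : Config d => y j = b)) with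
        (fun k : A => y k) = z, pmf q y = marginal q A x := by
      unfold marginal
      refine Finset.sum_congr ?_ fun _ _ => rfl
      ext y
      simp only [Finset.mem_filter, Finset.mem_univ, true_and, funext_iff, Subtype.forall]
      constructor
      · rintro ⟨_, h⟩ k hk
        rw [h k hk, hx k hk]
      · intro h
        have h' : ∀ k (hk : k ∈ A), y k = z ⟨k, hk⟩ := fun k hk => by rw [h k hk, hx k hk]
        exact ⟨by rw [h' j hjA, hz], h'⟩
    have h2 : ∑ y ∈ (Finset.univ.filter (fun y : Config d => y i = a ∧ y j = b)) with
        (fun k : A => y k) = z, pmf q y = marginal q (insert i A) (Function.update x i a) := by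
      unfold marginal
      refine Finset.sum_congr ?_ fun _ _ => rfl
      ext y
      simp only [Finset.mem_filter, Finset.mem_univ, true_and, funext_iff, Subtype.forall,
        Finset.mem_insert, forall_eq_or_imp, Function.update_self]
      constructor
      · rintro ⟨⟨h1, _⟩, h⟩
        refine ⟨h1, fun k hk => ?_⟩
        rw [Function.update_of_ne (ne_of_mem_of_not_mem hk hiA), h k hk, hx k hk]
      · rintro ⟨h1, h⟩
        have h' : ∀ k (hk : k ∈ A), y k = z ⟨k, hk⟩ := fun k hk => by
          rw [h k hk, Function.update_of_ne (ne_of_mem_of_not_mem hk hiA), hx k hk]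
        exact ⟨⟨h1, by rw [h' j hjA, hz]⟩, h'⟩
    rw [h1, h2, marginal_eq_prod hqac _ hA, marginal_eq_prod hqac _ hiA',
      Finset.prod_insert hiA, Function.update_self, hcond _ (fun _ => 0)]
    congr 1
    refine Finset.prod_congr rfl fun k hk => ?_
    rw [Function.update_of_ne (ne_of_mem_of_not_mem hk hiA)]
    exact condProb_congr _ _ _ fun m hm =>
      Function.update_of_ne (ne_of_mem_of_not_mem (hA m k hm hk) hiA) _ _
  · have hempty : ∀ (s : Finset (Config d)), (∀ y ∈ s, y j = b) →
        ∑ y ∈ s with (fun k : A => y k) = z, pmf q y = 0 := by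
      intro s hs
      rw [Finset.filter_false_of_mem, Finset.sum_empty]
      intro y hy h
      exact hz (by rw [← h]; exact hs y hy)
    rw [hempty, hempty, mul_zero]
    · simp
    · simp

/-! ### Smoothness of the log-likelihood -/

lemma contDiff_cut (k : Fin p) {n : WithTop ℕ∞} :
    ContDiff ℝ n (fun φ : Param d => cut k φ) := by
  rw [contDiff_euclidean]
  rintro (q | q)
  · by_cases h : q.1 = k
    · simpa [cut, h] using contDiff_const
    · simp only [cut, h, if_false]
      fun_prop
  · simp only [cut]
    fun_prop

lemma contDiff_score (j : Fin p) (l : Fin (d j + 1)) (x : Config d) {n : WithTop ℕ∞} :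
    ContDiff ℝ n (fun φ : Param d => score φ j l x) := by
  simp only [score, intercept, group_apply]
  fun_prop

lemma contDiff_condProb (j : Fin p) (l : Fin (d j + 1)) (x : Config d) {n : WithTop ℕ∞} :
    ContDiff ℝ n (fun φ : Param d => condProb φ j l x) := by
  unfold condProb
  refine ContDiff.div (Real.contDiff_exp.comp (contDiff_score j l x)) ?_
    fun φ => (sum_exp_score_pos φ j x).ne'
  exact ContDiff.sum fun m _ => Real.contDiff_exp.comp (contDiff_score j m x)

lemma contDiff_pmf (x : Config d) {n : WithTop ℕ∞} :
    ContDiff ℝ n (fun φ : Param d => pmf φ x) := by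
  unfold pmf
  exact contDiff_prod fun j _ => contDiff_condProb j _ x

lemma contDiff_log_pmf_cut (k : Fin p) (x : Config d) {n : WithTop ℕ∞} :
    ContDiff ℝ n (fun φ : Param d => Real.log (pmf (cut k φ) x)) :=
  ContDiff.log ((contDiff_pmf x).comp (contDiff_cut k)) fun _ => (pmf_pos _ _).ne'

lemma exists_pos_le_of_continuous {ι E : Type*} [Finite ι] [NormedAddCommGroup E]
    [ProperSpace E] {f : ι → E → ℝ} (hf : ∀ i, Continuous (f i)) (hpos : ∀ i u, 0 < f i u)
    (B : ℝ) : ∃ δ > 0, ∀ i φ, ‖φ‖ ≤ B → δ ≤ f i φ := by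
  have h1 : ∀ i, ∃ δ > 0, ∀ φ, ‖φ‖ ≤ B → δ ≤ f i φ := by
    intro i
    rcases (Metric.closedBall (0 : E) B).eq_empty_or_nonempty with h | h
    · refine ⟨1, one_pos, fun φ hφ => ?_⟩
      have : φ ∈ Metric.closedBall (0 : E) B := by simpa using hφ
      simp [h] at this
    · obtain ⟨z, -, hz⟩ := (isCompact_closedBall (0 : E) B).exists_isMinOn h (hf i).continuousOn
      exact ⟨f i z, hpos i z, fun φ hφ => hz (by simpa using hφ)⟩
  choose δ hδ h using h1
  cases isEmpty_or_nonempty ι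
  · exact ⟨1, one_pos, fun i => isEmptyElim i⟩
  · obtain ⟨i₀, hi₀⟩ := Finite.exists_min δ
    exact ⟨δ i₀, hδ i₀, fun i φ hφ => (hi₀ i).trans (h i φ hφ)⟩

/-- Lower bound of the conditional probabilities on a ball. -/
lemma exists_pos_le_condProb_cut (d : Fin p → ℕ) (B : ℝ) :
    ∃ δ > 0, ∀ φ : Param d, ‖φ‖ ≤ B → ∀ k j l x, δ ≤ condProb (cut k φ) j l x := by
  obtain ⟨δ, hδ, h⟩ := exists_pos_le_of_continuous
    (f := fun (i : (Fin p × (Σ j : Fin p, Fin (d j + 1))) × Config d) (φ : Param d) =>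
      condProb (cut i.1.1 φ) i.1.2.1 i.1.2.2 i.2)
    (fun i => ((contDiff_condProb _ _ _ (n := 0)).comp (contDiff_cut _)).continuous)
    (fun _ _ => condProb_pos _ _ _ _) B
  exact ⟨δ, hδ, fun φ hφ k j l x => h ((k, ⟨j, l⟩), x) φ hφ⟩

/-! ### Linear structure of the parametrization -/

/-- The linear constraints that hold on the parameter space. -/
def IsCentered (u : Param d) : Prop :=
  (∀ j, intercept u j 0 = 0) ∧
    (∀ j i, ∀ a : Fin (d i), ∑ m : Fin (d j + 1), group u j i (m, a) = 0) ∧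
    ∀ j, group u j j = 0

lemma Acyclic.group_self {φ : Param d} (h : Acyclic φ) (j : Fin p) : group φ j j = 0 := by
  by_contra hne
  exact h j (Relation.TransGen.single hne)

lemma isCentered_of_mem {φ : Param d} (h : φ ∈ paramSpace d) : IsCentered φ :=
  ⟨h.2.1, h.2.2, h.1.group_self⟩

lemma group_sub (φ ψ : Param d) (j i : Fin p) : group (φ - ψ) j i = group φ j i - group ψ j i :=
  rfl

lemma intercept_sub (φ ψ : Param d) (j : Fin p) (l : Fin (d j + 1)) :
    intercept (φ - ψ) j l = intercept φ j l - intercept ψ j l := rfl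

/-- Acyclicity is lost under differences, but the linear constraints are not; this lets the
reconstruction from score contrasts be applied to `φ - φs`. -/
lemma IsCentered.sub {φ ψ : Param d} (h : IsCentered φ) (h' : IsCentered ψ) :
    IsCentered (φ - ψ) := by
  refine ⟨fun j => ?_, fun j i a => ?_, fun j => ?_⟩
  · simp [intercept_sub, h.1 j, h'.1 j]
  · simp [group_sub, Finset.sum_sub_distrib, h.2.1 j i a, h'.2.1 j i a]
  · simp [group_sub, h.2.2 j, h'.2.2 j]

lemma score_sub (φ ψ : Param d) (j : Fin p) (l : Fin (d j + 1)) (x : Config d) :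
    score (φ - ψ) j l x = score φ j l x - score ψ j l x := by
  simp only [score, group_sub, intercept_sub, PiLp.sub_apply, mul_sub, Finset.sum_sub_distrib]
  ring

lemma cut_sub (k : Fin p) (φ ψ : Param d) : cut k (φ - ψ) = cut k φ - cut k ψ := by
  ext (q | q)
  · by_cases h : q.1 = k <;> simp [cut, h]
  · simp [cut]

lemma log_condProb (φ : Param d) (j : Fin p) (l : Fin (d j + 1)) (x : Config d) :
    Real.log (condProb φ j l x) =
      score φ j l x - Real.log (∑ m : Fin (d j + 1), Real.exp (score φ j m x)) := by
  rw [condProb, Real.log_div (Real.exp_pos _).ne' (sum_exp_score_pos φ j x).ne', Real.log_exp]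

lemma norm_le_card_mul {ι : Type*} [Fintype ι] {u : EuclideanSpace ℝ ι} {c : ℝ}
    (h : ∀ i, |u i| ≤ c) : ‖u‖ ≤ Fintype.card ι * c := by
  have h1 : ‖u‖ ≤ ∑ i, |u i| := by
    rw [EuclideanSpace.norm_eq]
    refine Real.sqrt_le_iff.2 ⟨Finset.sum_nonneg fun _ _ => abs_nonneg _, ?_⟩
    simpa using Finset.sum_sq_le_sq_sum_of_nonneg (s := Finset.univ) (f := fun i => |u i|)
      fun _ _ => abs_nonneg _
  refine h1.trans ((Finset.sum_le_sum fun i _ => h i).trans ?_)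
  simp

lemma dummy_zero {k : ℕ} (a : Fin k) : dummy (0 : Fin (k + 1)) a = 0 := by
  simp [dummy, Fin.succ_ne_zero, eq_comm]

lemma dummy_succ {k : ℕ} (a b : Fin k) : dummy a.succ b = if a = b then 1 else 0 := by
  simp [dummy]

lemma score_zero (u : Param d) (j : Fin p) (l : Fin (d j + 1)) :
    score u j l (fun _ => 0) = intercept u j l := by
  simp [score, dummy_zero]

lemma score_single (u : Param d) (j i : Fin p) (l : Fin (d j + 1)) (a : Fin (d i)) :
    score u j l (Function.update (fun _ => 0) i a.succ) = intercept u j l + group u j i (l, a) := by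
  unfold score
  congr 1
  rw [Finset.sum_eq_single i]
  · simp [dummy_succ]
  · intro b _ hb
    simp [Function.update_of_ne hb, dummy_zero]
  · simp

/-- The score contrasts determine the parameter. -/
lemma norm_le_of_score_contrast_le {u : Param d} (hu : IsCentered u) {c : ℝ} (hc : 0 ≤ c)
    (h : ∀ k j l x, |score (cut k u) j l x - score (cut k u) j 0 x| ≤ c) :
    ‖u‖ ≤ Fintype.card (ParamIdx d) * (4 * c) := by
  refine norm_le_card_mul ?_
  rintro (⟨j, i, l, a⟩ | ⟨j, l⟩)
  · change |group u j i (l, a)| ≤ 4 * c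
    by_cases hij : i = j
    · subst hij
      simp [hu.2.2 i, hc]
    have hg : ∀ m, |group u j i (m, a) - group u j i (0, a)| ≤ 2 * c := by
      intro m
      -- Intervening on `i ≠ j` leaves the groups of `j` intact. Subtracting the contrast at the
      -- all-reference configuration isolates one dummy variable.
      have h1 := h i j m (Function.update (fun _ => 0) i a.succ)
      have h2 := h i j m (fun _ => 0)
      rw [score_single, score_single, group_cut, if_neg (Ne.symm hij)] at h1
      rw [score_zero, score_zero] at h2
      rw [abs_le] at *
      constructor <;> linarith [h1.1, h1.2, h2.1, h2.2]
    have hsum := hu.2.1 j i a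
    have hr : (0 : ℝ) < (d j + 1 : ℝ) := by positivity
    -- The entries sum to zero over the levels, so each one is the average of its differences from
    -- the others.
    have h3 : (d j + 1 : ℝ) * group u j i (l, a) =
        ∑ m, (group u j i (l, a) - group u j i (m, a)) := by
      rw [Finset.sum_sub_distrib, hsum]
      simp
    have h4 : (d j + 1 : ℝ) * |group u j i (l, a)| ≤ (d j + 1) * (4 * c) := by
      rw [← abs_of_pos hr, ← abs_mul, abs_of_pos hr, h3]
      refine (Finset.abs_sum_le_sum_abs _ _).trans ?_
      refine (Finset.sum_le_sum (g := fun _ => 4 * c) fun m _ => ?_).trans (by simp)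
      have h5 := hg l
      have h6 := hg m
      rw [abs_le] at *
      constructor <;> linarith [h5.1, h5.2, h6.1, h6.2]
    exact le_of_mul_le_mul_left h4 hr
  · change |intercept u j l| ≤ 4 * c
    have h2 := h j j l (fun _ => 0)
    rw [score_zero, score_zero, intercept_cut, intercept_cut, hu.1 j, sub_zero] at h2
    linarith

/-! ### Separation of the interventional distributions -/

/-- The total distance of the interventional distributions of two parameters. -/
def pmfDist (φ ψ : Param d) : ℝ :=
  ∑ k : Fin p, ∑ x : Config d, |pmf (cut k φ) x - pmf (cut k ψ) x|

lemma pmfDist_nonneg (φ ψ : Param d) : 0 ≤ pmfDist φ ψ :=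
  Finset.sum_nonneg fun _ _ => Finset.sum_nonneg fun _ _ => abs_nonneg _

lemma abs_sum_pmf_sub_le (φ ψ : Param d) (k : Fin p) (s : Finset (Config d)) :
    |∑ y ∈ s, pmf (cut k φ) y - ∑ y ∈ s, pmf (cut k ψ) y| ≤ pmfDist φ ψ := by
  rw [← Finset.sum_sub_distrib]
  refine (Finset.abs_sum_le_sum_abs _ _).trans ?_
  refine (Finset.sum_le_sum_of_subset_of_nonneg (Finset.subset_univ s)
    fun _ _ _ => abs_nonneg _).trans ?_
  exact Finset.single_le_sum
    (f := fun k => ∑ x : Config d, |pmf (cut k φ) x - pmf (cut k ψ) x|)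
    (fun _ _ => Finset.sum_nonneg fun _ _ => abs_nonneg _) (Finset.mem_univ k)

/-- Both conditional probabilities are ratios of marginals over `ancestors φ j`, with and without
`j`, because this set is parent-closed for both graphs. Only the denominator belonging to `ψ` has to
be bounded away from zero. -/
lemma abs_condProb_sub_le {φ ψ : Param d} (hφ : Acyclic φ) (hψ : Acyclic ψ)
    (h : ∀ i j, Edge ψ i j → Ancestor φ i j) {δ : ℝ} (hδ : 0 < δ)
    (hδψ : ∀ k x, δ ≤ pmf (cut k ψ) x) (k j : Fin p) (l : Fin (d j + 1)) (x : Config d) :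
    |condProb (cut k φ) j l x - condProb (cut k ψ) j l x| ≤ 2 / δ * pmfDist φ ψ := by
  -- Without loops the conditional law of `X j` ignores coordinate `j`, which may thus be set to the
  -- level `l`.
  have hupd : ∀ {θ : Param d}, Acyclic θ → condProb (cut k θ) j l x =
      condProb (cut k θ) j ((Function.update x j l) j) (Function.update x j l) := by
    intro θ hθ
    rw [Function.update_self]
    refine condProb_congr _ _ _ fun i hi => ?_
    have : i ≠ j := by
      rintro rfl
      exact hi.of_cut.1 (hθ.group_self i)
    rw [Function.update_of_ne this]
  rw [hupd hφ, hupd hψ]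
  generalize Function.update x j l = z
  have h1 := condProb_mul_marginal hφ (hφ.cut k)
    (fun i j h => Relation.TransGen.single h.of_cut.1) j z
  have h2 := condProb_mul_marginal hφ (hψ.cut k) (fun i j hij => h i j hij.of_cut.1) j z
  have h3 := abs_sum_pmf_sub_le φ ψ k
    (Finset.univ.filter (fun y : Config d => ∀ i ∈ ancestors φ j, y i = z i))
  have h4 := abs_sum_pmf_sub_le φ ψ k
    (Finset.univ.filter (fun y : Config d => ∀ i ∈ insert j (ancestors φ j), y i = z i))
  change |marginal _ _ _ - marginal _ _ _| ≤ _ at h3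
  change |marginal _ _ _ - marginal _ _ _| ≤ _ at h4
  have hb : δ ≤ marginal (cut k ψ) (ancestors φ j) z := by
    refine (hδψ k z).trans ?_
    unfold marginal
    exact Finset.single_le_sum (f := fun y => pmf (cut k ψ) y) (fun y _ => (pmf_pos _ y).le)
      (by simp)
  have hc1 := condProb_le_one (cut k φ) j (z j) z
  have hc0 := condProb_pos (cut k φ) j (z j) z
  set c := condProb (cut k φ) j (z j) z
  set c' := condProb (cut k ψ) j (z j) z
  set b := marginal (cut k φ) (ancestors φ j) z
  set b' := marginal (cut k ψ) (ancestors φ j) z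
  set D := pmfDist φ ψ
  have h5 : |(c - c') * b'| ≤ 2 * D := by
    have : (c - c') * b' = -(c * (b - b')) + (c * b - c' * b') := by ring
    rw [this, h1, h2]
    refine (abs_add_le _ _).trans ?_
    rw [abs_neg, abs_mul, abs_of_pos hc0]
    nlinarith [abs_nonneg (b - b')]
  rw [abs_mul, abs_of_pos (hδ.trans_le hb)] at h5
  rw [div_mul_eq_mul_div, le_div_iff₀ hδ]
  nlinarith [abs_nonneg (c - c')]

lemma abs_log_sub_log_le {a b δ : ℝ} (hδ : 0 < δ) (ha : δ ≤ a) (hb : δ ≤ b) :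
    |Real.log a - Real.log b| ≤ |a - b| / δ := by
  have aux : ∀ {a b : ℝ}, δ ≤ a → δ ≤ b → Real.log a - Real.log b ≤ |a - b| / δ := by
    intro a b ha hb
    have ha' := hδ.trans_le ha
    have hb' := hδ.trans_le hb
    rw [← Real.log_div ha'.ne' hb'.ne']
    have h1 := Real.log_le_sub_one_of_pos (div_pos ha' hb')
    have h2 : a / b - 1 = (a - b) / b := by field_simp
    rw [h2] at h1
    refine h1.trans (((div_le_div_iff_of_pos_right hb').2 (le_abs_self _)).trans ?_)
    exact div_le_div_of_nonneg_left (abs_nonneg _) hδ hb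
  rw [abs_le]
  have h1 := aux ha hb
  have h2 := aux hb ha
  rw [abs_sub_comm b a] at h2
  constructor <;> linarith

/-- Lipschitz reconstruction of the parameter when the ancestral relations are compatible. -/
lemma exists_norm_sub_le_of_ancestor {φs : Param d} (hφs : φs ∈ paramSpace d) (B : ℝ) :
    ∃ c > 0, ∀ φ ∈ paramSpace d, ‖φ‖ ≤ B → (∀ i j, Edge φs i j → Ancestor φ i j) →
      ‖φ - φs‖ ≤ c * pmfDist φ φs := by
  obtain ⟨δ, hδ, hcond⟩ := exists_pos_le_condProb_cut d (max B ‖φs‖)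
  obtain ⟨δ', hδ', hpmf⟩ := exists_pos_le_of_continuous
    (f := fun (i : Fin p × Config d) (φ : Param d) => pmf (cut i.1 φ) i.2)
    (fun i => ((contDiff_pmf _ (n := 0)).comp (contDiff_cut _)).continuous)
    (fun _ _ => pmf_pos _ _) ‖φs‖
  refine ⟨(Fintype.card (ParamIdx d) + 1) * (4 * (2 * (2 / δ' / δ))), by positivity, ?_⟩
  intro φ hφ hB hanc
  have hD := pmfDist_nonneg φ φs
  have hlog : ∀ k j l x, |Real.log (condProb (cut k φ) j l x) -
      Real.log (condProb (cut k φs) j l x)| ≤ 2 / δ' / δ * pmfDist φ φs := by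
    intro k j l x
    refine (abs_log_sub_log_le hδ (hcond φ (hB.trans (le_max_left _ _)) k j l x)
      (hcond φs (le_max_right _ _) k j l x)).trans ?_
    rw [div_right_comm, div_mul_eq_mul_div, div_mul_eq_mul_div, mul_div_assoc, mul_div_assoc,
      div_right_comm, ← mul_div_assoc]
    refine (div_le_div_iff_of_pos_right hδ).2 ?_
    refine (abs_condProb_sub_le hφ.1 hφs.1 hanc hδ' (fun k x => hpmf (k, x) φs le_rfl)
      k j l x).trans (le_of_eq ?_)
    ring
  have hc := norm_le_of_score_contrast_le (u := φ - φs)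
    ((isCentered_of_mem hφ).sub (isCentered_of_mem hφs))
    -- The log-normalizer cancels in a contrast of two log-probabilities, each of which contributes
    -- one error.
    (c := 2 * (2 / δ' / δ * pmfDist φ φs)) (by positivity) (by
      intro k j l x
      rw [cut_sub, score_sub, score_sub]
      have h1 := hlog k j l x
      have h2 := hlog k j 0 x
      simp only [log_condProb] at h1 h2
      rw [abs_le] at *
      constructor <;> linarith [h1.1, h1.2, h2.1, h2.2])
  refine hc.trans ?_
  have hnn : 0 ≤ 4 * (2 * (2 / δ' / δ * pmfDist φ φs)) := by positivity
  nlinarith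

/-! ### Dependence between a node and its ancestors -/

lemma jointLaw_apply (φ : Param d) (s : Set (Config d)) [DecidablePred (· ∈ s)] :
    jointLaw φ s = ENNReal.ofReal (∑ y ∈ Finset.univ.filter (· ∈ s), pmf φ y) := by
  rw [ENNReal.ofReal_sum_of_nonneg fun y _ => (pmf_pos φ y).le, Finset.sum_filter]
  simp only [jointLaw, Measure.coe_finsetSum, Finset.sum_apply, Measure.smul_apply, smul_eq_mul]
  refine Finset.sum_congr rfl fun y _ => ?_
  rw [Measure.dirac_apply' _ s.toFinite.measurableSet]
  by_cases hy : y ∈ s <;> simp [hy]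

lemma isProbabilityMeasure_jointLaw {φ : Param d} (h : Acyclic φ) :
    IsProbabilityMeasure (jointLaw φ) := by
  classical
  constructor
  rw [jointLaw_apply]
  simp [sum_pmf h]

/-- The covariance of the indicators of two events, each concerning one variable. -/
def pairDefect (φ : Param d) (i j : Fin p) (a : Fin (d i + 1)) (b : Fin (d j + 1)) : ℝ :=
  ∑ y ∈ Finset.univ.filter (fun y : Config d => y i = a ∧ y j = b), pmf φ y -
    (∑ y ∈ Finset.univ.filter (fun y : Config d => y i = a), pmf φ y) *
      ∑ y ∈ Finset.univ.filter (fun y : Config d => y j = b), pmf φ y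

lemma exists_pairDefect_ne_zero {φ : Param d} (hφ : Acyclic φ) {i j : Fin p}
    (h : ¬ IndepFun (fun x : Config d => x i) (fun x : Config d => x j) (jointLaw φ)) :
    ∃ a b, pairDefect φ i j a b ≠ 0 := by
  classical
  by_contra! hcon
  apply h
  have := isProbabilityMeasure_jointLaw hφ
  have hm : ∀ k, Measurable (fun x : Config d => x k) := fun k => measurable_pi_apply k
  rw [indepFun_iff_map_prod_eq_prod_map_map (hm i).aemeasurable (hm j).aemeasurable]
  have : IsProbabilityMeasure ((jointLaw φ).map (fun x : Config d => x i)) :=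
    Measure.isProbabilityMeasure_map (hm _).aemeasurable
  have : IsProbabilityMeasure ((jointLaw φ).map (fun x : Config d => x j)) :=
    Measure.isProbabilityMeasure_map (hm _).aemeasurable
  refine Measure.ext_of_singleton fun ⟨a, b⟩ => ?_
  rw [← Set.singleton_prod_singleton, Measure.prod_prod,
    Measure.map_apply (hm i) (MeasurableSet.singleton _),
    Measure.map_apply (hm j) (MeasurableSet.singleton _),
    Measure.map_apply ((hm i).prodMk (hm j))
      ((MeasurableSet.singleton _).prod (MeasurableSet.singleton _)), jointLaw_apply, jointLaw_apply,
    jointLaw_apply, ← ENNReal.ofReal_mul (Finset.sum_nonneg fun y _ => (pmf_pos φ y).le)]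
  congr 1
  have := hcon a b
  rw [pairDefect, sub_eq_zero] at this
  simpa using this

lemma abs_pairDefect_sub_le {φ ψ : Param d} (hφ : Acyclic φ) (hψ : Acyclic ψ) (k i j : Fin p)
    (a : Fin (d i + 1)) (b : Fin (d j + 1)) :
    |pairDefect (cut k φ) i j a b - pairDefect (cut k ψ) i j a b| ≤ 3 * pmfDist φ ψ := by
  have bd : ∀ {θ : Param d}, Acyclic θ → ∀ s : Finset (Config d),
      0 ≤ ∑ y ∈ s, pmf (cut k θ) y ∧ ∑ y ∈ s, pmf (cut k θ) y ≤ 1 := by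
    intro θ hθ s
    refine ⟨Finset.sum_nonneg fun y _ => (pmf_pos _ y).le, ?_⟩
    rw [← sum_pmf (hθ.cut k)]
    exact Finset.sum_le_sum_of_subset_of_nonneg (Finset.subset_univ s)
      fun y _ _ => (pmf_pos _ y).le
  unfold pairDefect
  have h1 := abs_sum_pmf_sub_le φ ψ k
    (Finset.univ.filter (fun y : Config d => y i = a ∧ y j = b))
  have h2 := abs_sum_pmf_sub_le φ ψ k (Finset.univ.filter (fun y : Config d => y i = a))
  have h3 := abs_sum_pmf_sub_le φ ψ k (Finset.univ.filter (fun y : Config d => y j = b))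
  have b2 := bd hψ (Finset.univ.filter (fun y : Config d => y i = a))
  have b3 := bd hφ (Finset.univ.filter (fun y : Config d => y j = b))
  generalize ∑ y ∈ Finset.univ.filter (fun y : Config d => y i = a ∧ y j = b), pmf (cut k φ) y =
    P at *
  generalize ∑ y ∈ Finset.univ.filter (fun y : Config d => y i = a ∧ y j = b), pmf (cut k ψ) y =
    P' at *
  generalize ∑ y ∈ Finset.univ.filter (fun y : Config d => y i = a), pmf (cut k φ) y =
    Q at *
  generalize ∑ y ∈ Finset.univ.filter (fun y : Config d => y i = a), pmf (cut k ψ) y =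
    Q' at *
  generalize ∑ y ∈ Finset.univ.filter (fun y : Config d => y j = b), pmf (cut k φ) y =
    R at *
  generalize ∑ y ∈ Finset.univ.filter (fun y : Config d => y j = b), pmf (cut k ψ) y =
    R' at *
  have e : P - Q * R - (P' - Q' * R') = (P - P') - (Q - Q') * R - Q' * (R - R') := by ring
  rw [e]
  have t1 : |(Q - Q') * R| ≤ pmfDist φ ψ := by
    rw [abs_mul, abs_of_nonneg b3.1]
    nlinarith [abs_nonneg (Q - Q')]
  have t2 : |Q' * (R - R')| ≤ pmfDist φ ψ := by
    rw [abs_mul, abs_of_nonneg b2.1]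
    nlinarith [abs_nonneg (R - R')]
  rw [abs_le] at *
  constructor <;> linarith [h1.1, h1.2, t1.1, t1.2, t2.1, t2.2]

/-- A natural parameter is separated from the parameters that miss one of its ancestral
relations. -/
lemma exists_le_pmfDist_of_natural {φs : Param d} (hφs : Acyclic φs) (hnat : Natural φs) :
    ∃ δ > 0, ∀ φ, Acyclic φ → (∃ i j, Ancestor φs i j ∧ ¬ Ancestor φ i j) →
      δ ≤ pmfDist φ φs := by
  have key : ∀ q : Fin p × Fin p, ∃ δ > 0, Ancestor φs q.1 q.2 → ∀ φ, Acyclic φ →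
      ¬ Ancestor φ q.1 q.2 → δ ≤ pmfDist φ φs := by
    rintro ⟨i, j⟩
    by_cases hij : Ancestor φs i j
    · obtain ⟨a, b, hab⟩ := exists_pairDefect_ne_zero (hφs.cut i) (hnat i j hij)
      refine ⟨|pairDefect (cut i φs) i j a b| / 3, by positivity, fun _ φ hφ hna => ?_⟩
      have hne : i ≠ j := by
        rintro rfl
        exact hφs i hij
      have h0 : pairDefect (cut i φ) i j a b = 0 := by
        rw [pairDefect, sub_eq_zero]
        exact sum_pmf_pair_eq_mul hφ hne hna a b
      have h1 := abs_pairDefect_sub_le hφ hφs i i j a b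
      rw [h0, zero_sub, abs_neg] at h1
      linarith
    · exact ⟨1, one_pos, fun h => absurd h hij⟩
  choose δ hδ h using key
  cases isEmpty_or_nonempty (Fin p × Fin p) with
  | inl he =>
    exact ⟨1, one_pos, fun φ _ ⟨i, j, _⟩ => he.elim (i, j)⟩
  | inr hne =>
    obtain ⟨q, hq⟩ := Finite.exists_min δ
    exact ⟨δ q, hδ q, fun φ hφ ⟨i, j, h1, h2⟩ => (hq (i, j)).trans (h (i, j) h1 φ hφ h2)⟩

/-- If an ancestral relation is missing, `pmfDist` is at least `δ`, and boundedness of `φ` alone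
yields a linear bound; otherwise the reconstruction applies. -/
theorem exists_norm_sub_le_pmfDist {φs : Param d} (hφs : φs ∈ paramSpace d)
    (hnat : Natural φs) (B : ℝ) :
    ∃ c > 0, ∀ φ ∈ paramSpace d, ‖φ‖ ≤ B → ‖φ - φs‖ ≤ c * pmfDist φ φs := by
  obtain ⟨c, hc, h1⟩ := exists_norm_sub_le_of_ancestor hφs B
  obtain ⟨δ, hδ, h2⟩ := exists_le_pmfDist_of_natural hφs.1 hnat
  refine ⟨c + (|B| + ‖φs‖) / δ, by positivity, fun φ hφ hB => ?_⟩
  have hD := pmfDist_nonneg φ φs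
  rw [add_mul]
  by_cases h : ∀ i j, Ancestor φs i j → Ancestor φ i j
  · have := h1 φ hφ hB fun i j hij => h i j (Relation.TransGen.single hij)
    have : 0 ≤ (|B| + ‖φs‖) / δ * pmfDist φ φs := by positivity
    linarith
  · push Not at h
    have h3 := h2 φ hφ.1 h
    have h4 : |B| + ‖φs‖ ≤ (|B| + ‖φs‖) / δ * pmfDist φ φs := by
      rw [div_mul_eq_mul_div, le_div_iff₀ hδ]
      exact mul_le_mul_of_nonneg_left h3 (by positivity)
    have h5 := norm_sub_le φ φs
    have h6 := le_abs_self B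
    have : 0 ≤ c * pmfDist φ φs := by positivity
    linarith

/-! ### Kullback-Leibler divergence -/

/-- With `s = √f` and `t = √g`, the bound `log (t / s) ≤ t / s - 1` makes each summand at least `(s
- t)² + (s² - t²)`. The second part sums to zero, and `(s² - t²)² ≤ 4 (s - t)²` as `s, t ≤ 1`. -/
lemma sum_mul_log_sub_log_ge {ι : Type*} [Fintype ι] {f g : ι → ℝ} (hf : ∀ i, 0 < f i)
    (hg : ∀ i, 0 < g i) (hf1 : ∑ i, f i = 1) (hg1 : ∑ i, g i = 1) :
    (∑ i, (f i - g i) ^ 2) / 4 ≤ ∑ i, f i * (Real.log (f i) - Real.log (g i)) := by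
  have hle1 : ∀ {h : ι → ℝ}, (∀ i, 0 < h i) → ∑ i, h i = 1 → ∀ i, h i ≤ 1 := by
    intro h hh h1 i
    rw [← h1]
    exact Finset.single_le_sum (fun i _ => (hh i).le) (Finset.mem_univ i)
  have hterm : ∀ i, (f i - g i) ^ 2 / 4 + (f i - g i) ≤
      f i * (Real.log (f i) - Real.log (g i)) := by
    intro i
    have hs := Real.sqrt_pos.2 (hf i)
    have ht := Real.sqrt_pos.2 (hg i)
    have hs2 := Real.sq_sqrt (hf i).le
    have ht2 := Real.sq_sqrt (hg i).le
    have hs1 : √(f i) ≤ 1 := Real.sqrt_le_one.2 (hle1 hf hf1 i)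
    have ht1 : √(g i) ≤ 1 := Real.sqrt_le_one.2 (hle1 hg hg1 i)
    set s := √(f i)
    set t := √(g i)
    rw [← hs2, ← ht2, Real.log_pow, Real.log_pow]
    have hlog := Real.log_le_sub_one_of_pos (div_pos ht hs)
    rw [Real.log_div ht.ne' hs.ne'] at hlog
    have h1 : s ^ 2 * (Real.log t - Real.log s) ≤ s * t - s ^ 2 := by
      calc _ ≤ s ^ 2 * (t / s - 1) := by gcongr
        _ = _ := by field_simp
    have h2 : (s ^ 2 - t ^ 2) ^ 2 / 4 ≤ (s - t) ^ 2 := by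
      have : (s ^ 2 - t ^ 2) ^ 2 = (s - t) ^ 2 * (s + t) ^ 2 := by ring
      rw [this]
      nlinarith [sq_nonneg (s - t), mul_nonneg (sq_nonneg (s - t))
        (show 0 ≤ 4 - (s + t) ^ 2 by nlinarith)]
    push_cast
    nlinarith
  calc (∑ i, (f i - g i) ^ 2) / 4 = ∑ i, ((f i - g i) ^ 2 / 4 + (f i - g i)) := by
        rw [Finset.sum_add_distrib, Finset.sum_sub_distrib, hf1, hg1, Finset.sum_div]
        ring
    _ ≤ _ := Finset.sum_le_sum fun i _ => hterm i

/-- The Kullback-Leibler divergence `∑ x, p(x|φs_[k]) log (p(x|φs_[k]) / p(x|φ_[k]))`. -/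
def klCut (φs : Param d) (k : Fin p) (φ : Param d) : ℝ :=
  ∑ x, pmf (cut k φs) x * (Real.log (pmf (cut k φs) x) - Real.log (pmf (cut k φ) x))

lemma klCut_ge {φs φ : Param d} (hφs : Acyclic φs) (hφ : Acyclic φ) (k : Fin p) :
    (∑ x, (pmf (cut k φs) x - pmf (cut k φ) x) ^ 2) / 4 ≤ klCut φs k φ :=
  sum_mul_log_sub_log_ge (fun _ => pmf_pos _ _) (fun _ => pmf_pos _ _) (sum_pmf (hφs.cut k))
    (sum_pmf (hφ.cut k))

lemma klCut_nonneg {φs φ : Param d} (hφs : Acyclic φs) (hφ : Acyclic φ) (k : Fin p) :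
    0 ≤ klCut φs k φ :=
  (div_nonneg (Finset.sum_nonneg fun _ _ => sq_nonneg _) (by norm_num)).trans
    (klCut_ge hφs hφ k)

lemma klCut_self (φs : Param d) (k : Fin p) : klCut φs k φs = 0 := by simp [klCut]

theorem exists_sq_norm_le_sum_klCut {φs : Param d} (hφs : φs ∈ paramSpace d)
    (hnat : Natural φs) (B : ℝ) :
    ∃ c > 0, ∀ φ ∈ paramSpace d, ‖φ‖ ≤ B → c * ‖φ - φs‖ ^ 2 ≤ ∑ k, klCut φs k φ := by
  obtain ⟨c, hc, h⟩ := exists_norm_sub_le_pmfDist hφs hnat B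
  set N : ℝ := (Fintype.card (Fin p × Config d) : ℝ) + 1
  have hN : 0 < N := by positivity
  refine ⟨(4 * N * c ^ 2)⁻¹, by positivity, fun φ hφ hB => ?_⟩
  have h1 := h φ hφ hB
  have h2 : pmfDist φ φs ^ 2 ≤ N * (4 * ∑ k, klCut φs k φ) := by
    have e : pmfDist φ φs =
        ∑ q : Fin p × Config d, |pmf (cut q.1 φ) q.2 - pmf (cut q.1 φs) q.2| := by
      rw [Fintype.sum_prod_type]; rfl
    have h3 := sq_sum_le_card_mul_sum_sq (s := (Finset.univ : Finset (Fin p × Config d)))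
      (f := fun q => |pmf (cut q.1 φ) q.2 - pmf (cut q.1 φs) q.2|)
    rw [← e] at h3
    have h4 : ∑ q : Fin p × Config d, |pmf (cut q.1 φ) q.2 - pmf (cut q.1 φs) q.2| ^ 2 ≤
        4 * ∑ k, klCut φs k φ := by
      rw [Fintype.sum_prod_type, Finset.mul_sum]
      refine Finset.sum_le_sum fun k _ => ?_
      have := klCut_ge hφs.1 hφ.1 k
      have e2 : ∑ x, |pmf (cut k φ) x - pmf (cut k φs) x| ^ 2 =
          ∑ x, (pmf (cut k φs) x - pmf (cut k φ) x) ^ 2 :=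
        Finset.sum_congr rfl fun x _ => by rw [sq_abs]; ring
      rw [e2]
      linarith
    have h5 : 0 ≤ ∑ q : Fin p × Config d, |pmf (cut q.1 φ) q.2 - pmf (cut q.1 φs) q.2| ^ 2 :=
      Finset.sum_nonneg fun _ _ => sq_nonneg _
    calc pmfDist φ φs ^ 2 ≤ _ := h3
      _ ≤ N * _ := mul_le_mul_of_nonneg_right (by simp [N]) h5
      _ ≤ _ := mul_le_mul_of_nonneg_left h4 hN.le
  rw [inv_mul_le_iff₀ (by positivity)]
  calc ‖φ - φs‖ ^ 2 ≤ (c * pmfDist φ φs) ^ 2 := by gcongr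
    _ = c ^ 2 * pmfDist φ φs ^ 2 := by ring
    _ ≤ c ^ 2 * (N * (4 * ∑ k, klCut φs k φ)) := by gcongr
    _ = _ := by ring

/-! ### Local Lipschitz bounds -/

lemma exists_norm_sub_le_of_contDiff {E F : Type*} [NormedAddCommGroup E] [NormedSpace ℝ E]
    [ProperSpace E] [NormedAddCommGroup F] [NormedSpace ℝ F] {f : E → F} (hf : ContDiff ℝ 1 f)
    (B : ℝ) : ∃ L > 0, ∀ u v, ‖u‖ ≤ B → ‖v‖ ≤ B → ‖f u - f v‖ ≤ L * ‖u - v‖ := by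
  obtain ⟨L, hL⟩ := (isCompact_closedBall (0 : E) B).exists_bound_of_continuousOn
    (hf.continuous_fderiv (by norm_num)).continuousOn
  refine ⟨max L 1, by positivity, fun u v hu hv => ?_⟩
  refine (convex_closedBall (0 : E) B).norm_image_sub_le_of_norm_fderiv_le
    (fun x _ => (hf.differentiable (by norm_num)) x)
    (fun x hx => (hL x hx).trans (le_max_left _ _)) ?_ ?_ <;> simpa

lemma exists_abs_log_pmf_sub_le (d : Fin p → ℕ) (B : ℝ) :
    ∃ L > 0, ∀ φ ψ : Param d, ‖φ‖ ≤ B → ‖ψ‖ ≤ B → ∀ k x,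
      |Real.log (pmf (cut k φ) x) - Real.log (pmf (cut k ψ) x)| ≤ L * ‖φ - ψ‖ := by
  have h := fun q : Fin p × Config d =>
    exists_norm_sub_le_of_contDiff (contDiff_log_pmf_cut (d := d) q.1 q.2 (n := 1)) B
  choose L hL h using h
  refine ⟨(∑ q, L q) + 1, by
    have := Finset.sum_nonneg (s := Finset.univ) fun q _ => (hL q).le
    positivity, fun φ ψ hφ hψ k x => (h (k, x) φ ψ hφ hψ).trans ?_⟩
  have := Finset.single_le_sum (fun q _ => (hL q).le) (Finset.mem_univ (k, x))
  exact mul_le_mul_of_nonneg_right (by linarith) (norm_nonneg _)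

lemma contDiff_klCut (φs : Param d) (k : Fin p) {n : WithTop ℕ∞} :
    ContDiff ℝ n (klCut φs k) := by
  unfold klCut
  exact ContDiff.sum fun x _ =>
    contDiff_const.mul (contDiff_const.sub (contDiff_log_pmf_cut k x))

lemma edge_add_smul_sub {φs φ φ' : Param d} (h1 : ∀ i j, Edge φs i j → Edge φ i j)
    (h2 : ∀ i j, Edge φ' i j → Edge φ i j) (t : ℝ) (i j : Fin p)
    (h : Edge (φs + t • (φ - φ')) i j) : Edge φ i j := by
  by_contra hφ
  have e1 : group φs j i = 0 := not_not.1 (mt (h1 i j) hφ)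
  have e2 : group φ' j i = 0 := not_not.1 (mt (h2 i j) hφ)
  have e3 : group φ j i = 0 := not_not.1 hφ
  apply h
  change group φs j i + t • (group φ j i - group φ' j i) = 0
  simp [e1, e2, e3]

/-- Along the line through `φs` in direction `φ - φ'` every graph is a subgraph of that of `φ`,
hence acyclic. So each `pmf` is normalized, the divergence is nonnegative, and it has a minimum at
`φs`. -/
lemma fderiv_klCut_eq_zero {φs φ φ' : Param d} (hφ : Acyclic φ)
    (h1 : ∀ i j, Edge φs i j → Edge φ i j) (h2 : ∀ i j, Edge φ' i j → Edge φ i j) (k : Fin p) :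
    fderiv ℝ (klCut φs k) φs (φ - φ') = 0 := by
  have hd : DifferentiableAt ℝ (klCut φs k) φs :=
    (contDiff_klCut φs k (n := 1)).differentiable (by norm_num) φs
  have hline := hd.hasFDerivAt.hasLineDerivAt (φ - φ')
  refine IsLocalMin.hasDerivAt_eq_zero ?_ hline
  refine Filter.Eventually.of_forall fun t => ?_
  simp only [zero_smul, add_zero, klCut_self]
  exact klCut_nonneg (hφ.mono h1) (hφ.mono (edge_add_smul_sub h1 h2 t)) k

/-- The derivative is locally Lipschitz and kills `φ - φ'` at `φs`, so within distance `r` it is of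
order `r` in this direction. With `r` of order `n^(-1/2)`, multiplication by `n` leaves order `√n`.
-/
lemma exists_abs_klCut_sub_le (φs : Param d) :
    ∃ K > 0, ∀ (φ φ' : Param d) (r : ℝ), r ≤ 1 → Acyclic φ →
      (∀ i j, Edge φs i j → Edge φ i j) → (∀ i j, Edge φ' i j → Edge φ i j) →
      ‖φ - φs‖ ≤ r → ‖φ' - φs‖ ≤ r →
      ∀ k, |klCut φs k φ - klCut φs k φ'| ≤ K * r * ‖φ - φ'‖ := by
  have h := fun k : Fin p => exists_norm_sub_le_of_contDiff
    ((contDiff_klCut φs k (n := 2)).fderiv_right (m := 1) (by norm_num)) (‖φs‖ + 1)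
  choose K hK h using h
  refine ⟨(∑ k, K k) + 1, by
    have := Finset.sum_nonneg (s := Finset.univ) fun q _ => (hK q).le
    positivity, ?_⟩
  intro φ φ' r hr hφ h1 h2 hφr hφ'r k
  have hr0 : 0 ≤ r := (norm_nonneg _).trans hφr
  have hz := fderiv_klCut_eq_zero hφ h1 h2 k
  have hmv := (convex_closedBall φs r).norm_image_sub_le_of_norm_fderiv_le'
    (f := klCut φs k) (φ := fderiv ℝ (klCut φs k) φs) (C := K k * r) (x := φ') (y := φ)
    (fun x _ => (contDiff_klCut φs k (n := 1)).differentiable (by norm_num) x)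
    (fun x hx => by
      have hx' : ‖x - φs‖ ≤ r := by simpa [dist_eq_norm] using hx
      have hxn : ‖x‖ ≤ ‖φs‖ + 1 := by
        have := norm_le_norm_add_norm_sub' x φs
        linarith
      exact (h k x φs hxn (by linarith)).trans (mul_le_mul_of_nonneg_left hx' (hK k).le))
    (by simpa [dist_eq_norm] using hφ'r) (by simpa [dist_eq_norm] using hφr)
  rw [hz, sub_zero, Real.norm_eq_abs] at hmv
  refine hmv.trans ?_
  have := Finset.single_le_sum (fun q _ => (hK q).le) (Finset.mem_univ k)
  gcongr
  linarith

/-! ### The parameter space -/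

lemma continuous_group (j i : Fin p) : Continuous (fun φ : Param d => group φ j i) := by
  unfold group
  fun_prop

lemma eventually_edge (φs : Param d) : ∀ᶠ φ in 𝓝 φs, ∀ i j, Edge φs i j → Edge φ i j := by
  simp only [eventually_all]
  intro i j hij
  exact (continuous_group j i).continuousAt.eventually_ne hij

/-- A directed cycle consists of finitely many non-zero groups, so it survives small perturbations.
-/
lemma isClosed_acyclic : IsClosed {φ : Param d | Acyclic φ} := by
  rw [← isOpen_compl_iff, isOpen_iff_mem_nhds]
  intro φ hφ
  filter_upwards [eventually_edge φ] with ψ hψ hac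
  exact hφ (hac.mono hψ)

lemma isClosed_paramSpace : IsClosed (paramSpace d) := by
  have h : paramSpace d = {φ | Acyclic φ} ∩ ({φ | ∀ j, intercept φ j 0 = 0} ∩
      {φ | ∀ j i, ∀ a : Fin (d i), ∑ m : Fin (d j + 1), group φ j i (m, a) = 0}) := rfl
  rw [h]
  refine isClosed_acyclic.inter (IsClosed.inter ?_ ?_)
  · simp only [Set.ofPred_forall]
    refine isClosed_iInter fun j => isClosed_eq ?_ continuous_const
    unfold intercept
    fun_prop
  · simp only [Set.ofPred_forall]
    refine isClosed_iInter fun j => isClosed_iInter fun i => isClosed_iInter fun a =>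
      isClosed_eq ?_ continuous_const
    simp only [group_apply]
    fun_prop

lemma sum_idx {M : Type*} [AddCommMonoid M] (f : ParamIdx d → M) :
    ∑ i, f i = ∑ j, ∑ i, ∑ q, f (Sum.inl ⟨j, i, q⟩) + ∑ j, ∑ l, f (Sum.inr ⟨j, l⟩) := by
  rw [Fintype.sum_sum_type, Fintype.sum_sigma, Fintype.sum_sigma]
  congr 1
  exact Finset.sum_congr rfl fun j _ => Fintype.sum_sigma _

lemma sq_norm_eq (u : Param d) :
    ‖u‖ ^ 2 = ∑ j, ∑ i, ‖group u j i‖ ^ 2 + ∑ j, ∑ l, intercept u j l ^ 2 := by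
  rw [EuclideanSpace.real_norm_sq_eq, sum_idx]
  congr 1
  exact Finset.sum_congr rfl fun j _ => Finset.sum_congr rfl fun i _ => by
    rw [EuclideanSpace.real_norm_sq_eq]; rfl

lemma norm_group_le (u : Param d) (j i : Fin p) : ‖group u j i‖ ≤ ‖u‖ := by
  refine le_of_sq_le_sq ?_ (norm_nonneg _)
  rw [sq_norm_eq]
  have h1 := Finset.single_le_sum (f := fun i => ‖group u j i‖ ^ 2)
    (fun _ _ => sq_nonneg _) (Finset.mem_univ i)
  have h2 := Finset.single_le_sum (f := fun j => ∑ i, ‖group u j i‖ ^ 2)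
    (fun _ _ => Finset.sum_nonneg fun _ _ => sq_nonneg _) (Finset.mem_univ j)
  have h3 : 0 ≤ ∑ j, ∑ l, intercept u j l ^ 2 :=
    Finset.sum_nonneg fun _ _ => Finset.sum_nonneg fun _ _ => sq_nonneg _
  linarith

lemma norm_le_sum_norm_group {u : Param d} (hu : ∀ j l, intercept u j l = 0) :
    ‖u‖ ≤ ∑ j, ∑ i, ‖group u j i‖ := by
  refine le_of_sq_le_sq ?_
    (Finset.sum_nonneg fun _ _ => Finset.sum_nonneg fun _ _ => norm_nonneg _)
  rw [sq_norm_eq]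
  simp only [hu, ne_eq, OfNat.ofNat_ne_zero, not_false_eq_true, zero_pow, Finset.sum_const_zero,
    add_zero]
  rw [← Fintype.sum_prod_type', ← Fintype.sum_prod_type']
  exact Finset.sum_sq_le_sq_sum_of_nonneg fun _ _ => norm_nonneg _

open Classical in
/-- Delete from `φ` the groups that vanish in `φs`. -/
def restrictTo (φs φ : Param d) : Param d :=
  WithLp.toLp 2 fun idx =>
    match idx with
    | Sum.inl q => if group φs q.1 q.2.1 = 0 then 0 else φ (Sum.inl q)
    | Sum.inr q => φ (Sum.inr q)

open Classical in
lemma group_restrictTo (φs φ : Param d) (j i : Fin p) :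
    group (restrictTo φs φ) j i = if group φs j i = 0 then 0 else group φ j i := by
  ext q
  by_cases h : group φs j i = 0
  · simp only [h, if_true]
    simp [group_apply, restrictTo, h]
  · simp only [h, if_false]
    simp [group_apply, restrictTo, h]

lemma intercept_restrictTo (φs φ : Param d) (j : Fin p) (l : Fin (d j + 1)) :
    intercept (restrictTo φs φ) j l = intercept φ j l := rfl

lemma edge_of_edge_restrictTo {φs φ : Param d} {i j : Fin p} (h : Edge (restrictTo φs φ) i j) :
    Edge φ i j := by
  unfold Edge at *
  rw [group_restrictTo] at h
  split_ifs at h with h'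
  · exact absurd rfl h
  · exact h

lemma restrictTo_mem {φs φ : Param d} (h : φ ∈ paramSpace d) :
    restrictTo φs φ ∈ paramSpace d := by
  refine ⟨h.1.mono fun i j => edge_of_edge_restrictTo, h.2.1, fun j i a => ?_⟩
  rw [group_restrictTo]
  split_ifs
  · simp
  · exact h.2.2 j i a

lemma norm_restrictTo_sub_le (φs φ : Param d) : ‖restrictTo φs φ - φs‖ ≤ ‖φ - φs‖ := by
  refine le_of_sq_le_sq ?_ (norm_nonneg _)
  rw [sq_norm_eq, sq_norm_eq]
  refine add_le_add (Finset.sum_le_sum fun j _ => Finset.sum_le_sum fun i _ => ?_) le_rfl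
  rw [group_sub, group_sub, group_restrictTo]
  split_ifs with h
  · simp [h]
  · exact le_rfl

/-! ### Log-likelihood in terms of cell counts -/

/-- The number of rows of block `k` that equal `y`. -/
def cellCount {n : ℕ} (blk : Fin n → Fin p) (x : Fin n → Config d) (k : Fin p) (y : Config d) : ℝ :=
  ((Finset.univ.filter fun h => blk h = k ∧ x h = y).card : ℝ)

lemma logLik_eq_sum_cellCount {n : ℕ} (blk : Fin n → Fin p) (x : Fin n → Config d)
    (φ : Param d) :
    logLik blk x φ = ∑ k, ∑ y, cellCount blk x k y * Real.log (pmf (cut k φ) y) := by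
  refine Finset.sum_congr rfl fun k _ => ?_
  rw [← Finset.sum_fiberwise (s := Finset.univ.filter fun h => blk h = k) (g := x)]
  refine Finset.sum_congr rfl fun y _ => ?_
  rw [Finset.sum_congr rfl (g := fun _ => Real.log (pmf (cut k φ) y))]
  · rw [Finset.sum_const, nsmul_eq_mul, Finset.filter_filter, cellCount]
  · intro h hh
    rw [(Finset.mem_filter.1 hh).2]

lemma cellCount_nonneg {n : ℕ} (blk : Fin n → Fin p) (x : Fin n → Config d) (k : Fin p)
    (y : Config d) : 0 ≤ cellCount blk x k y := Nat.cast_nonneg _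

lemma cellCount_le {n : ℕ} (blk : Fin n → Fin p) (x : Fin n → Config d) (k : Fin p)
    (y : Config d) : cellCount blk x k y ≤ n := by
  unfold cellCount
  exact_mod_cast (Finset.card_le_univ _).trans (by simp)

lemma blockSize_le {n : ℕ} (blk : Fin n → Fin p) (k : Fin p) : blockSize blk k ≤ n :=
  (Finset.card_le_univ _).trans (by simp)

lemma log_pmf_nonpos (φ : Param d) (x : Config d) : Real.log (pmf φ x) ≤ 0 :=
  Real.log_nonpos (pmf_pos _ _).le (pmf_le_one _ _)

/-- Comparison of the log-likelihood with its expectation. -/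
lemma logLik_sub_le {φs φ φ' : Param d} {n : ℕ} {blk : Fin n → Fin p} {x : Fin n → Config d}
    {ε L : ℝ} (hε : ∀ k y, |cellCount blk x k y - blockSize blk k * pmf (cut k φs) y| ≤ ε)
    (hL : ∀ k y, |Real.log (pmf (cut k φ) y) - Real.log (pmf (cut k φ') y)| ≤ L) :
    logLik blk x φ - logLik blk x φ' ≤ Fintype.card (Fin p × Config d) * (ε * L) +
      ∑ k, blockSize blk k * (klCut φs k φ' - klCut φs k φ) := by
  -- Centred counts carry the fluctuation; their means carry the divergences.
  have e : logLik blk x φ - logLik blk x φ' =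
      ∑ k, ∑ y, (cellCount blk x k y - blockSize blk k * pmf (cut k φs) y) *
        (Real.log (pmf (cut k φ) y) - Real.log (pmf (cut k φ') y)) +
      ∑ k, blockSize blk k * (klCut φs k φ' - klCut φs k φ) := by
    rw [logLik_eq_sum_cellCount, logLik_eq_sum_cellCount, ← Finset.sum_sub_distrib,
      ← Finset.sum_add_distrib]
    refine Finset.sum_congr rfl fun k _ => ?_
    rw [klCut, klCut, ← Finset.sum_sub_distrib, ← Finset.sum_sub_distrib, Finset.mul_sum,
      ← Finset.sum_add_distrib]
    exact Finset.sum_congr rfl fun y _ => by ring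
  rw [e]
  gcongr
  rw [← Fintype.sum_prod_type']
  refine (Finset.sum_le_sum (g := fun _ => ε * L) fun q _ => ?_).trans (by simp)
  refine (le_abs_self _).trans ?_
  rw [abs_mul]
  exact mul_le_mul (hε _ _) (hL _ _) (abs_nonneg _) ((abs_nonneg _).trans (hε q.1 q.2))

/-- Parameters with a large likelihood are bounded. -/
lemma norm_le_of_le_logLik {φ : Param d} (hφ : φ ∈ paramSpace d) {n : ℕ} {blk : Fin n → Fin p}
    {x : Fin n → Config d} {w c : ℝ} (hw : 0 < w) (hc : 0 ≤ c)
    (hcount : ∀ k y, w ≤ cellCount blk x k y) (hlik : -(c * w) ≤ logLik blk x φ) :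
    ‖φ‖ ≤ Fintype.card (ParamIdx d) * (4 * c) := by
  have hpmf : ∀ k y, -c ≤ Real.log (pmf (cut k φ) y) := by
    intro k y
    -- All summands are nonpositive, so any single one bounds the total from above.
    have h1 : logLik blk x φ ≤ cellCount blk x k y * Real.log (pmf (cut k φ) y) := by
      rw [logLik_eq_sum_cellCount, ← Fintype.sum_prod_type',
        ← Finset.add_sum_erase _ _ (Finset.mem_univ (k, y))]
      refine add_le_of_nonpos_right (Finset.sum_nonpos fun q _ => ?_)
      exact mul_nonpos_of_nonneg_of_nonpos (cellCount_nonneg _ _ _ _) (log_pmf_nonpos _ _)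
    have h2 : cellCount blk x k y * Real.log (pmf (cut k φ) y) ≤
        w * Real.log (pmf (cut k φ) y) :=
      mul_le_mul_of_nonpos_right (hcount k y) (log_pmf_nonpos _ _)
    nlinarith
  have hcond : ∀ k j l y, -c ≤ Real.log (condProb (cut k φ) j l y) ∧
      Real.log (condProb (cut k φ) j l y) ≤ 0 := by
    intro k j l y
    refine ⟨?_, Real.log_nonpos (condProb_pos _ _ _ _).le (condProb_le_one _ _ _ _)⟩
    have e : condProb (cut k φ) j l y =
        condProb (cut k φ) j ((Function.update y j l) j) (Function.update y j l) := by
      rw [Function.update_self]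
      refine condProb_congr _ _ _ fun i hi => ?_
      have : i ≠ j := by
        rintro rfl
        exact hi.of_cut.1 (hφ.1.group_self i)
      rw [Function.update_of_ne this]
    rw [e]
    exact (hpmf k (Function.update y j l)).trans
      (Real.log_le_log (pmf_pos _ _) (pmf_le_condProb _ _ _))
  refine norm_le_of_score_contrast_le (isCentered_of_mem hφ) hc fun k j l y => ?_
  have h1 := hcond k j l y
  have h2 := hcond k j 0 y
  simp only [log_condProb] at h1 h2
  rw [abs_le]
  constructor <;> linarith [h1.1, h1.2, h2.1, h2.2]

/-! ### The penalized log-likelihood as a real number -/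

/-- The groups with an infinite weight vanish. -/
def Feasible (τ : Fin p → Fin p → ℝ≥0∞) (φ : Param d) : Prop :=
  ∀ j i, τ j i = ∞ → group φ j i = 0

/-- The value of the penalty on feasible parameters. -/
def realPen (lam : ℝ) (τ : Fin p → Fin p → ℝ≥0∞) (φ : Param d) : ℝ :=
  lam * ∑ j, ∑ i, (τ j i).toReal * ‖group φ j i‖

lemma realPen_nonneg {lam : ℝ} (hlam : 0 < lam) (τ : Fin p → Fin p → ℝ≥0∞) (φ : Param d) :
    0 ≤ realPen lam τ φ :=
  mul_nonneg hlam.le (Finset.sum_nonneg fun _ _ => Finset.sum_nonneg fun _ _ => by positivity)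

lemma penLogLik_of_feasible {n : ℕ} (blk : Fin n → Fin p) (x : Fin n → Config d) {lam : ℝ}
    (hlam : 0 < lam) {τ : Fin p → Fin p → ℝ≥0∞} {φ : Param d} (h : Feasible τ φ) :
    penLogLik blk x lam τ φ = ((logLik blk x φ - realPen lam τ φ : ℝ) : EReal) := by
  have e : ENNReal.ofReal lam * ∑ j, ∑ i, τ j i * ‖group φ j i‖ₑ =
      ENNReal.ofReal (realPen lam τ φ) := by
    rw [realPen, ENNReal.ofReal_mul hlam.le, ENNReal.ofReal_sum_of_nonneg fun _ _ =>
      Finset.sum_nonneg fun _ _ => by positivity]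
    congr 1
    refine Finset.sum_congr rfl fun j _ => ?_
    rw [ENNReal.ofReal_sum_of_nonneg fun _ _ => by positivity]
    refine Finset.sum_congr rfl fun i _ => ?_
    rw [ENNReal.ofReal_mul ENNReal.toReal_nonneg, ofReal_norm]
    -- `toReal` sends `∞` to `0`, which is harmless because the group vanishes there.
    by_cases hτ : τ j i = ∞
    · simp [h j i hτ]
    · rw [ENNReal.ofReal_toReal hτ]
  rw [penLogLik, e, EReal.coe_ennreal_ofReal, max_eq_left (realPen_nonneg hlam τ φ),
    EReal.coe_sub]

lemma penLogLik_of_not_feasible {n : ℕ} (blk : Fin n → Fin p) (x : Fin n → Config d) {lam : ℝ}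
    (hlam : 0 < lam) {τ : Fin p → Fin p → ℝ≥0∞} {φ : Param d} (h : ¬ Feasible τ φ) :
    penLogLik blk x lam τ φ = ⊥ := by
  simp only [Feasible, not_forall] at h
  obtain ⟨j, i, hτ, hg⟩ := h
  have e : ENNReal.ofReal lam * ∑ j, ∑ i, τ j i * ‖group φ j i‖ₑ = ∞ := by
    have h1 : τ j i * ‖group φ j i‖ₑ = ∞ := by
      rw [hτ]
      exact ENNReal.top_mul (by simpa using hg)
    have h2 : ∑ j, ∑ i, τ j i * ‖group φ j i‖ₑ = ∞ :=
      ENNReal.sum_eq_top.2 ⟨j, Finset.mem_univ _, ENNReal.sum_eq_top.2 ⟨i, Finset.mem_univ _, h1⟩⟩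
    rw [h2]
    exact ENNReal.mul_top (by simpa using hlam)
  rw [penLogLik, e]
  simp

lemma continuous_logLik {n : ℕ} (blk : Fin n → Fin p) (x : Fin n → Config d) :
    Continuous (logLik (d := d) blk x) := by
  unfold logLik
  exact continuous_finsetSum _ fun k _ => continuous_finsetSum _ fun h _ =>
    (contDiff_log_pmf_cut k (x h) (n := 0)).continuous

lemma continuous_realPen (lam : ℝ) (τ : Fin p → Fin p → ℝ≥0∞) :
    Continuous (realPen (d := d) lam τ) := by
  unfold realPen
  exact continuous_const.mul (continuous_finsetSum _ fun j _ => continuous_finsetSum _ fun i _ =>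
    continuous_const.mul (continuous_group j i).norm)

lemma isClosed_feasible (τ : Fin p → Fin p → ℝ≥0∞) : IsClosed {φ : Param d | Feasible τ φ} := by
  simp only [Feasible, Set.ofPred_forall]
  exact isClosed_iInter fun j => isClosed_iInter fun i => isClosed_iInter fun _ =>
    isClosed_eq (continuous_group j i) continuous_const

/-- The feasible parameters in the ball form a compact set; those outside it do worse than `φs`, and
infeasible ones have value `⊥`. -/
lemma exists_isMaxOn_penLogLik {n : ℕ} (blk : Fin n → Fin p) (x : Fin n → Config d) {lam : ℝ}
    (hlam : 0 < lam) {τ : Fin p → Fin p → ℝ≥0∞} {φs : Param d} (hφs : φs ∈ paramSpace d)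
    (hfs : Feasible τ φs) {B : ℝ} (hB : ∀ φ ∈ paramSpace d, Feasible τ φ →
      logLik blk x φs - realPen lam τ φs ≤ logLik blk x φ - realPen lam τ φ → ‖φ‖ ≤ B) :
    ∃ φ ∈ paramSpace d, IsMaxOn (penLogLik blk x lam τ) (paramSpace d) φ := by
  have hcomp : IsCompact ((paramSpace d ∩ {φ | Feasible τ φ}) ∩ Metric.closedBall 0 B) :=
    (isCompact_closedBall _ _).inter_left (isClosed_paramSpace.inter (isClosed_feasible τ))
  have hs : φs ∈ (paramSpace d ∩ {φ | Feasible τ φ}) ∩ Metric.closedBall 0 B :=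
    ⟨⟨hφs, hfs⟩, by simpa using hB φs hφs hfs le_rfl⟩
  obtain ⟨φ, hφ, hmax⟩ := hcomp.exists_isMaxOn ⟨φs, hs⟩
    ((continuous_logLik blk x).sub (continuous_realPen lam τ)).continuousOn
  refine ⟨φ, hφ.1.1, fun ψ hψ => ?_⟩
  change penLogLik blk x lam τ ψ ≤ penLogLik blk x lam τ φ
  by_cases hf : Feasible τ ψ
  · rw [penLogLik_of_feasible blk x hlam hf, penLogLik_of_feasible blk x hlam hφ.1.2,
      EReal.coe_le_coe_iff]
    by_cases hle : logLik blk x φs - realPen lam τ φs ≤ logLik blk x ψ - realPen lam τ ψ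
    · exact hmax ⟨⟨hψ, hf⟩, by simpa using hB ψ hψ hf hle⟩
    · exact (not_le.1 hle).le.trans (hmax hs)
  · rw [penLogLik_of_not_feasible blk x hlam hf]
    exact bot_le

lemma feasible_and_le_of_isMaxOn {n : ℕ} {blk : Fin n → Fin p} {x : Fin n → Config d} {lam : ℝ}
    (hlam : 0 < lam) {τ : Fin p → Fin p → ℝ≥0∞} {φ ψ : Param d}
    (h : IsMaxOn (penLogLik blk x lam τ) (paramSpace d) φ) (hψ : ψ ∈ paramSpace d)
    (hf : Feasible τ ψ) : Feasible τ φ ∧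
      logLik blk x ψ - realPen lam τ ψ ≤ logLik blk x φ - realPen lam τ φ := by
  have h1 : penLogLik blk x lam τ ψ ≤ penLogLik blk x lam τ φ := h hψ
  rw [penLogLik_of_feasible blk x hlam hf] at h1
  by_cases hφ : Feasible τ φ
  · rw [penLogLik_of_feasible blk x hlam hφ, EReal.coe_le_coe_iff] at h1
    exact ⟨hφ, h1⟩
  · rw [penLogLik_of_not_feasible blk x hlam hφ] at h1
    exact absurd h1 (not_le.2 (EReal.bot_lt_coe _))

/-! ### Adaptive weights -/

lemma adaptiveWeight_le {γ t : ℝ} (hγ : 0 < γ) (ht : 0 < t) {ψ : ∀ j i : Fin p, Group d j i}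
    {j i : Fin p} (h : t ≤ ‖ψ j i‖) : adaptiveWeight γ ψ j i ≤ ENNReal.ofReal (t ^ (-γ)) := by
  refine (min_le_left _ _).trans ?_
  rw [← ENNReal.ofReal_rpow_of_pos ht, ENNReal.rpow_neg, ENNReal.rpow_neg, ENNReal.inv_le_inv,
    ← ofReal_norm]
  exact ENNReal.rpow_le_rpow (ENNReal.ofReal_le_ofReal h) hγ.le

lemma le_adaptiveWeight {γ t : ℝ} (hγ : 0 < γ) (ht : 0 < t) {ψ : ∀ j i : Fin p, Group d j i}
    {j i : Fin p} (h : ‖ψ j i‖ ≤ t) (h' : ‖ψ i j‖ ≤ t) :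
    ENNReal.ofReal (t ^ (-γ)) ≤ adaptiveWeight γ ψ j i := by
  refine le_min ?_ ?_ <;>
  · rw [← ENNReal.ofReal_rpow_of_pos ht, ENNReal.rpow_neg, ENNReal.rpow_neg, ENNReal.inv_le_inv,
      ← ofReal_norm]
    exact ENNReal.rpow_le_rpow (ENNReal.ofReal_le_ofReal (by assumption)) hγ.le

lemma feasible_of_weight_le {φs : Param d} {τ : Fin p → Fin p → ℝ≥0∞} {T : ℝ}
    (h : ∀ j i, group φs j i ≠ 0 → τ j i ≤ ENNReal.ofReal T) : Feasible τ φs := by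
  intro j i hτ
  by_contra hne
  have := h j i hne
  rw [hτ] at this
  exact absurd this (by simp)

/-- Only weights of groups present in `φs` need a bound: the remaining groups contribute nonpositive
terms. -/
lemma realPen_sub_le {φs : Param d} {τ : Fin p → Fin p → ℝ≥0∞} {T lam : ℝ} (hT : 0 ≤ T)
    (hlam : 0 < lam) (h : ∀ j i, group φs j i ≠ 0 → τ j i ≤ ENNReal.ofReal T) (φ : Param d) :
    realPen lam τ φs - realPen lam τ φ ≤ lam * (p ^ 2 * (T * ‖φ - φs‖)) := by
  rw [realPen, realPen, ← mul_sub]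
  refine mul_le_mul_of_nonneg_left ?_ hlam.le
  simp only [← Finset.sum_sub_distrib]
  have hterm : ∀ j i, (τ j i).toReal * ‖group φs j i‖ - (τ j i).toReal * ‖group φ j i‖ ≤
      T * ‖φ - φs‖ := by
    intro j i
    by_cases h0 : group φs j i = 0
    · have h1 : 0 ≤ (τ j i).toReal * ‖group φ j i‖ := by positivity
      have h2 : 0 ≤ T * ‖φ - φs‖ := by positivity
      rw [h0, norm_zero, mul_zero]
      linarith
    · have h1 : (τ j i).toReal ≤ T := ENNReal.toReal_le_of_le_ofReal hT (h j i h0)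
      have h2 : ‖group φs j i‖ - ‖group φ j i‖ ≤ ‖φ - φs‖ := by
        refine (norm_sub_norm_le _ _).trans ?_
        rw [norm_sub_rev, ← group_sub]
        exact norm_group_le _ _ _
      rw [← mul_sub]
      calc _ ≤ (τ j i).toReal * ‖φ - φs‖ := by gcongr
        _ ≤ _ := by gcongr
  refine (Finset.sum_le_sum fun j _ => Finset.sum_le_sum fun i _ => hterm j i).trans ?_
  simp only [Finset.sum_const, Finset.card_univ, Fintype.card_fin, nsmul_eq_mul]
  exact le_of_eq (by ring)

lemma realPen_zero (lam : ℝ) (τ : Fin p → Fin p → ℝ≥0∞) : realPen (d := d) lam τ 0 = 0 := by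
  have : ∀ j i, group (0 : Param d) j i = 0 := fun j i => rfl
  simp [realPen, this]

lemma exists_pos_le_norm_group (φs : Param d) :
    ∃ b > 0, ∀ j i, group φs j i ≠ 0 → b ≤ ‖group φs j i‖ := by
  have h : ∀ q : Fin p × Fin p, ∃ b > 0, group φs q.1 q.2 ≠ 0 → b ≤ ‖group φs q.1 q.2‖ := by
    intro q
    by_cases h : group φs q.1 q.2 = 0
    · exact ⟨1, one_pos, fun h' => absurd h h'⟩
    · exact ⟨_, norm_pos_iff.2 h, fun _ => le_rfl⟩
  choose b hb h using h
  cases isEmpty_or_nonempty (Fin p × Fin p) with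
  | inl he => exact ⟨1, one_pos, fun j i => he.elim (j, i)⟩
  | inr hne =>
    obtain ⟨q, hq⟩ := Finite.exists_min b
    exact ⟨b q, hb q, fun j i hji => (hq (j, i)).trans (h (j, i) hji)⟩

/-- A row count and an initial estimate are `M`-accurate at scale `√n`. -/
structure Accurate (φs : Param d) (M : ℝ) {n : ℕ} (blk : Fin n → Fin p) (x : Fin n → Config d)
    (ψ : ∀ j i : Fin p, Group d j i) : Prop where
  count : ∀ k y, |cellCount blk x k y - blockSize blk k * pmf (cut k φs) y| ≤ M * √n
  est : ∀ j i, ‖ψ j i - group φs j i‖ ≤ M * (√n)⁻¹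

/-- For accurate data the penalized likelihood has a maximizer, and all are `√n`-consistent. -/
lemma exists_eventually_consistent {φs : Param d} (hφs : φs ∈ paramSpace d)
    (hnat : Natural φs) (blk : ∀ n : ℕ, Fin n → Fin p) {a : ℝ} (ha : 0 < a)
    (hblk : ∀ᶠ n : ℕ in atTop, ∀ k, a * n ≤ blockSize (blk n) k) {γ : ℝ} (hγ : 0 < γ)
    {lam : ℕ → ℝ} (hlam : ∀ n, 0 < lam n) (hlam_le : ∀ᶠ n : ℕ in atTop, lam n ≤ √n)
    {M : ℝ} (hM : 0 < M) :
    ∃ C > 0, ∀ᶠ n : ℕ in atTop, ∀ (x : Fin n → Config d) (ψ : ∀ j i : Fin p, Group d j i),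
      Accurate φs M (blk n) x ψ →
      (∃ φ ∈ paramSpace d,
        IsMaxOn (penLogLik (blk n) x (lam n) (adaptiveWeight γ ψ)) (paramSpace d) φ) ∧
      Feasible (adaptiveWeight γ ψ) φs ∧
      ∀ φ ∈ paramSpace d,
        IsMaxOn (penLogLik (blk n) x (lam n) (adaptiveWeight γ ψ)) (paramSpace d) φ →
        ‖φ - φs‖ ≤ C * (√n)⁻¹ := by
  obtain ⟨b, hb, hbs⟩ := exists_pos_le_norm_group φs
  obtain ⟨π, hπ, hπs⟩ := exists_pos_le_of_continuous
    (f := fun (i : Fin p × Config d) (φ : Param d) => pmf (cut i.1 φ) i.2)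
    (fun i => ((contDiff_pmf _ (n := 0)).comp (contDiff_cut _)).continuous)
    (fun _ _ => pmf_pos _ _) ‖φs‖
  -- Bounds the weights of active groups once their initial estimates have norm at least `b / 2`.
  set T : ℝ := (b / 2) ^ (-γ) with hTdef
  have hT : 0 < T := Real.rpow_pos_of_pos (by positivity) _
  -- Expected cell counts are at least `a * π * n`; half of this absorbs the error `M * √n`.
  set w : ℝ := a * π / 2 with hwdef
  have hw : 0 < w := by positivity
  set K : ℝ := ∑ k, ∑ y, |Real.log (pmf (cut k φs) y)| + p ^ 2 * (T * ‖φs‖) with hKdef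
  have hK : 0 ≤ K := add_nonneg
    (Finset.sum_nonneg fun _ _ => Finset.sum_nonneg fun _ _ => abs_nonneg _) (by positivity)
  set B : ℝ := max (Fintype.card (ParamIdx d) * (4 * (K / w))) ‖φs‖
  obtain ⟨c, hc, hkl⟩ := exists_sq_norm_le_sum_klCut hφs hnat B
  obtain ⟨L, hL, hLip⟩ := exists_abs_log_pmf_sub_le d B
  set C₀ : ℝ := Fintype.card (Fin p × Config d) * (M * L) + p ^ 2 * T
  have hC₀ : 0 ≤ C₀ := by positivity
  have hsqrt : Tendsto (fun n : ℕ => √(n : ℝ)) atTop atTop :=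
    Real.tendsto_sqrt_atTop.comp tendsto_natCast_atTop_atTop
  refine ⟨C₀ / (a * c) + 1, by positivity, ?_⟩
  filter_upwards [hblk, hlam_le, hsqrt.eventually_ge_atTop 1,
    hsqrt.eventually_ge_atTop (M / w), hsqrt.eventually_ge_atTop (M / (b / 2))]
    with n hblkn hlamn hn1 hnw hnb x ψ hacc
  set s : ℝ := √(n : ℝ)
  have hs : 0 < s := by linarith
  have hsn : s ^ 2 = n := Real.sq_sqrt (Nat.cast_nonneg n)
  have hsle : s ≤ n := by nlinarith
  set τ := adaptiveWeight γ ψ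
  have hτ : ∀ j i, group φs j i ≠ 0 → τ j i ≤ ENNReal.ofReal T := by
    intro j i hji
    refine adaptiveWeight_le hγ (by positivity) ?_
    have h1 := hacc.est j i
    have h2 := hbs j i hji
    have h3 : M * s⁻¹ ≤ b / 2 := by
      rw [← div_eq_mul_inv, div_le_iff₀ hs]
      rw [div_le_iff₀ (by positivity)] at hnb
      linarith
    have h4 : ‖group φs j i‖ ≤ ‖ψ j i‖ + ‖ψ j i - group φs j i‖ := norm_le_insert _ _
    linarith
  have hfs : Feasible τ φs := feasible_of_weight_le hτ
  have hcount : ∀ k y, w * n ≤ cellCount (blk n) x k y := by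
    intro k y
    have h1 := (abs_le.1 (hacc.count k y)).1
    have h2 : a * n * π ≤ blockSize (blk n) k * pmf (cut k φs) y :=
      mul_le_mul (hblkn k) (hπs (k, y) φs le_rfl) hπ.le (Nat.cast_nonneg _)
    have h3 : M * s ≤ w * n := by
      rw [div_le_iff₀ hw] at hnw
      rw [← hsn]
      nlinarith
    have h4 : w * n + w * n = a * n * π := by rw [hwdef]; ring
    linarith
  have hn0 : 0 < (n : ℝ) := by nlinarith
  have hlik_s : -(∑ k, ∑ y, |Real.log (pmf (cut k φs) y)|) * n ≤ logLik (blk n) x φs := by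
    rw [logLik_eq_sum_cellCount, ← Finset.sum_neg_distrib, Finset.sum_mul]
    refine Finset.sum_le_sum fun k _ => ?_
    rw [← Finset.sum_neg_distrib, Finset.sum_mul]
    refine Finset.sum_le_sum fun y _ => ?_
    have h1 := cellCount_le (blk n) x k y
    have h2 := cellCount_nonneg (blk n) x k y
    have h3 := log_pmf_nonpos (cut k φs) y
    rw [abs_of_nonpos h3]
    nlinarith
  have hbound : ∀ φ ∈ paramSpace d,
      logLik (blk n) x φs - realPen (lam n) τ φs ≤ logLik (blk n) x φ - realPen (lam n) τ φ →
      ‖φ‖ ≤ B := by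
    intro φ hφ hle
    -- Comparison with the zero parameter bounds the penalty of `φs` itself.
    have h1 := realPen_sub_le hT.le (hlam n) hτ 0
    rw [realPen_zero, sub_zero, zero_sub, norm_neg] at h1
    have h2 := realPen_nonneg (hlam n) τ φ
    have h3 : lam n * (p ^ 2 * (T * ‖φs‖)) ≤ n * (p ^ 2 * (T * ‖φs‖)) :=
      mul_le_mul_of_nonneg_right (hlamn.trans hsle) (by positivity)
    refine (norm_le_of_le_logLik hφ (w := w * n) (c := K / w) (by positivity) (by positivity)
      hcount ?_).trans (le_max_left _ _)
    have h4 : K / w * (w * n) = K * n := by field_simp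
    rw [h4, hKdef]
    linarith
  refine ⟨exists_isMaxOn_penLogLik (blk n) x (hlam n) hφs hfs (B := B)
    fun φ hφ _ hle => hbound φ hφ hle, hfs, ?_⟩
  intro φ hφ hmax
  obtain ⟨-, hle⟩ := feasible_and_le_of_isMaxOn (hlam n) hmax hφs hfs
  have hφB := hbound φ hφ hle
  have h1 := logLik_sub_le hacc.count (hLip φ φs hφB (le_max_right _ _))
  simp only [klCut_self, zero_sub, mul_neg, Finset.sum_neg_distrib] at h1
  have h2 := realPen_sub_le hT.le (hlam n) hτ φ
  have h3 : lam n * (p ^ 2 * (T * ‖φ - φs‖)) ≤ s * (p ^ 2 * (T * ‖φ - φs‖)) :=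
    mul_le_mul_of_nonneg_right hlamn (by positivity)
  have h4 : a * n * (c * ‖φ - φs‖ ^ 2) ≤ ∑ k, blockSize (blk n) k * klCut φs k φ := by
    calc a * n * (c * ‖φ - φs‖ ^ 2) ≤ a * n * ∑ k, klCut φs k φ := by
          gcongr
          exact hkl φ hφ hφB
      _ ≤ _ := by
          rw [Finset.mul_sum]
          exact Finset.sum_le_sum fun k _ =>
            mul_le_mul_of_nonneg_right (hblkn k) (klCut_nonneg hφs.1 hφ.1 k)
  -- Basic inequality: quadratic divergence loss against linear fluctuation and penalty terms.
  have h5 : a * n * (c * ‖φ - φs‖ ^ 2) ≤ s * C₀ * ‖φ - φs‖ := by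
    have : s * C₀ * ‖φ - φs‖ = Fintype.card (Fin p × Config d) * (M * s * (L * ‖φ - φs‖)) +
      s * (p ^ 2 * (T * ‖φ - φs‖)) := by ring
    linarith
  rcases (norm_nonneg (φ - φs)).eq_or_lt with h0 | hpos
  · rw [← h0]
    positivity
  have h6 : s * ‖φ - φs‖ * (a * c) ≤ C₀ := by
    refine le_of_mul_le_mul_left (a := s * ‖φ - φs‖) ?_ (by positivity)
    calc _ = a * s ^ 2 * (c * ‖φ - φs‖ ^ 2) := by ring
      _ ≤ s * C₀ * ‖φ - φs‖ := by rw [hsn]; exact h5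
      _ = _ := by ring
  rw [← div_eq_mul_inv, le_div_iff₀ hs]
  have h7 := (le_div_iff₀ (by positivity)).2 h6
  linarith

/-- Consistent maximizers of the penalized likelihood vanish on the groups that are absent from
the true parameter. -/
lemma eventually_sparse {φs : Param d} (blk : ∀ n : ℕ, Fin n → Fin p) {γ : ℝ} (hγ : 0 < γ)
    {lam : ℕ → ℝ} (hlam : ∀ n, 0 < lam n)
    (hlam_pow : Tendsto (fun n : ℕ => lam n * (n : ℝ) ^ ((γ - 1) / 2)) atTop atTop)
    {M C : ℝ} (hM : 0 < M) (hC : 0 < C) :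
    ∀ᶠ n : ℕ in atTop, ∀ (x : Fin n → Config d) (ψ : ∀ j i : Fin p, Group d j i),
      Accurate φs M (blk n) x ψ → Feasible (adaptiveWeight γ ψ) φs →
      ∀ φ ∈ paramSpace d,
        IsMaxOn (penLogLik (blk n) x (lam n) (adaptiveWeight γ ψ)) (paramSpace d) φ →
        ‖φ - φs‖ ≤ C * (√n)⁻¹ → ∀ j i, group φs j i = 0 → group φ j i = 0 := by
  obtain ⟨ρ, hρ, hedge⟩ := Metric.eventually_nhds_iff.1 (eventually_edge φs)
  obtain ⟨L, hL, hLip⟩ := exists_abs_log_pmf_sub_le d (‖φs‖ + 1)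
  obtain ⟨K, hK, hgrad⟩ := exists_abs_klCut_sub_le φs
  set K₁ : ℝ := Fintype.card (Fin p × Config d) * (M * L) + p * (K * C)
  have hsqrt : Tendsto (fun n : ℕ => √(n : ℝ)) atTop atTop :=
    Real.tendsto_sqrt_atTop.comp tendsto_natCast_atTop_atTop
  filter_upwards [hsqrt.eventually_ge_atTop 1, hsqrt.eventually_ge_atTop C,
    hsqrt.eventually_gt_atTop (C / ρ), hlam_pow.eventually_gt_atTop (K₁ * M ^ γ)]
    with n hn1 hnC hnρ hnlam x ψ hacc hfs φ hφ hmax hclose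
  set s : ℝ := √(n : ℝ)
  have hs : 0 < s := by linarith
  have hsn : s ^ 2 = n := Real.sq_sqrt (Nat.cast_nonneg n)
  have hn0 : 0 < (n : ℝ) := by nlinarith
  set τ := adaptiveWeight γ ψ
  have hr1 : C * s⁻¹ ≤ 1 := by
    rw [← div_eq_mul_inv, div_le_one hs]
    exact hnC
  have hE : ∀ i j, Edge φs i j → Edge φ i j := by
    refine hedge ?_
    rw [dist_eq_norm]
    refine hclose.trans_lt ?_
    rw [← div_eq_mul_inv, div_lt_iff₀ hs]
    rw [div_lt_iff₀ hρ] at hnρ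
    linarith
  set φ' := restrictTo φs φ with hφ'def
  have hφ' : φ' ∈ paramSpace d := restrictTo_mem hφ
  have hclose' : ‖φ' - φs‖ ≤ C * s⁻¹ := (norm_restrictTo_sub_le φs φ).trans hclose
  have hfeas : Feasible τ φ := (feasible_and_le_of_isMaxOn (hlam n) hmax
    (ψ := φ') hφ' (fun j i hji => by
      rw [group_restrictTo]
      simp [hfs j i hji])).1
  have hle := (feasible_and_le_of_isMaxOn (hlam n) hmax
    (ψ := φ') hφ' (fun j i hji => by
      rw [group_restrictTo]
      simp [hfs j i hji])).2
  have hdiff : ∀ j i, group (φ - φ') j i = if group φs j i = 0 then group φ j i else 0 := by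
    intro j i
    rw [group_sub, group_restrictTo]
    split_ifs <;> simp
  set S : ℝ := ∑ j, ∑ i, ‖group (φ - φ') j i‖ with hSdef
  have hS0 : 0 ≤ S := Finset.sum_nonneg fun _ _ => Finset.sum_nonneg fun _ _ => norm_nonneg _
  have hnormS : ‖φ - φ'‖ ≤ S := norm_le_sum_norm_group fun j l => by
    rw [intercept_sub, intercept_restrictTo, sub_self]
  have hball : ∀ θ : Param d, ‖θ - φs‖ ≤ C * s⁻¹ → ‖θ‖ ≤ ‖φs‖ + 1 := by
    intro θ hθ
    have := norm_le_norm_add_norm_sub' θ φs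
    linarith
  have hlik : logLik (blk n) x φ - logLik (blk n) x φ' ≤ s * K₁ * ‖φ - φ'‖ := by
    have h1 := logLik_sub_le hacc.count (hLip φ φ' (hball φ hclose) (hball φ' hclose'))
    have h2 : ∑ k, blockSize (blk n) k * (klCut φs k φ' - klCut φs k φ) ≤
        p * (n * (K * (C * s⁻¹) * ‖φ - φ'‖)) := by
      refine (Finset.sum_le_sum (g := fun _ => n * (K * (C * s⁻¹) * ‖φ - φ'‖))
        fun k _ => ?_).trans (by simp)
      have h3 := hgrad φ φ' (C * s⁻¹) hr1 hφ.1 hE (fun i j => edge_of_edge_restrictTo)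
        hclose hclose' k
      rw [abs_sub_comm] at h3
      have h4 : (blockSize (blk n) k : ℝ) ≤ n := by exact_mod_cast blockSize_le (blk n) k
      calc _ ≤ (blockSize (blk n) k : ℝ) * (K * (C * s⁻¹) * ‖φ - φ'‖) :=
            mul_le_mul_of_nonneg_left ((le_abs_self _).trans h3) (Nat.cast_nonneg _)
        _ ≤ _ := mul_le_mul_of_nonneg_right h4 (by positivity)
    have h5 : (n : ℝ) * s⁻¹ = s := by
      rw [← hsn]
      field_simp
    have h6 : p * (n * (K * (C * s⁻¹) * ‖φ - φ'‖)) = s * (p * (K * C)) * ‖φ - φ'‖ := by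
      calc _ = (n * s⁻¹) * (p * (K * C)) * ‖φ - φ'‖ := by ring
        _ = _ := by rw [h5]
    calc _ ≤ Fintype.card (Fin p × Config d) * (M * s * (L * ‖φ - φ'‖)) +
          s * (p * (K * C)) * ‖φ - φ'‖ := by linarith
      _ = _ := by ring
  have hpen : lam n * ((M * s⁻¹) ^ (-γ) * S) ≤ realPen (lam n) τ φ - realPen (lam n) τ φ' := by
    rw [realPen, realPen, ← mul_sub]
    refine mul_le_mul_of_nonneg_left ?_ (hlam n).le
    simp only [hSdef, Finset.mul_sum, ← Finset.sum_sub_distrib]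
    refine Finset.sum_le_sum fun j _ => Finset.sum_le_sum fun i _ => ?_
    rw [hdiff, group_restrictTo]
    by_cases h0 : group φs j i = 0
    swap
    · simp [h0]
    by_cases h1 : group φ j i = 0
    · simp [h1]
    simp only [h0, if_true, norm_zero, mul_zero, sub_zero]
    refine mul_le_mul_of_nonneg_right ?_ (norm_nonneg _)
    -- The reversed edge in `φs` would persist in `φ` and close a 2-cycle; hence both norms in the
    -- weight are small.
    have h2 : group φs i j = 0 := by
      by_contra h2
      exact hφ.1 i ((Relation.TransGen.single (show Edge φ i j from h1)).tail (hE j i h2))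
    have h3 := hacc.est j i
    have h4 := hacc.est i j
    rw [h0, sub_zero] at h3
    rw [h2, sub_zero] at h4
    have h5 := le_adaptiveWeight hγ (by positivity) h3 h4
    exact (ENNReal.ofReal_le_iff_le_toReal fun htop => h1 (hfeas j i htop)).1 h5
  have hSle : lam n * ((M * s⁻¹) ^ (-γ) * S) ≤ s * K₁ * S := by
    have : s * K₁ * ‖φ - φ'‖ ≤ s * K₁ * S := mul_le_mul_of_nonneg_left hnormS (by positivity)
    linarith
  -- The growth assumption on `lam` enters here, through `s ^ γ = n ^ ((γ - 1) / 2) * s`.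
  have hlt : s * K₁ < lam n * (M * s⁻¹) ^ (-γ) := by
    have e1 : (M * s⁻¹) ^ (-γ) = (M ^ γ)⁻¹ * s ^ γ := by
      rw [Real.mul_rpow hM.le (by positivity), Real.rpow_neg hM.le,
        Real.inv_rpow hs.le, Real.rpow_neg hs.le, inv_inv]
    have e2 : s ^ γ = (n : ℝ) ^ ((γ - 1) / 2) * s := by
      have : (n : ℝ) ^ ((γ - 1) / 2) = s ^ (γ - 1) := by
        rw [← hsn, ← Real.rpow_natCast, ← Real.rpow_mul hs.le]
        congr 1
        push_cast
        ring
      rw [this, Real.rpow_sub_one hs.ne']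
      field_simp
    have hMγ := Real.rpow_pos_of_pos hM γ
    rw [e1, e2]
    calc s * K₁ = K₁ * M ^ γ * (s * (M ^ γ)⁻¹) := by field_simp
      _ < (lam n * (n : ℝ) ^ ((γ - 1) / 2)) * (s * (M ^ γ)⁻¹) :=
          mul_lt_mul_of_pos_right hnlam (by positivity)
      _ = _ := by ring
  have hSz : S = 0 := by
    by_contra hne
    have hSpos : 0 < S := lt_of_le_of_ne hS0 (Ne.symm hne)
    nlinarith
  intro j i hji
  have h1 : ‖φ - φ'‖ = 0 := le_antisymm (hnormS.trans_eq hSz) (norm_nonneg _)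
  have h2 := norm_group_le (φ - φ') j i
  rw [h1, hdiff, if_pos hji] at h2
  exact norm_le_zero_iff.1 h2

/-! ### Concentration of the cell counts -/

/-- Chebyshev's inequality for a sum of at most `n` independent indicators, each of variance at most
one. -/
lemma measure_cellCount_le {S : Type*} [MeasurableSpace S] {P : Measure S}
    [IsProbabilityMeasure P] {φs : Param d} {n : ℕ} {blk : Fin n → Fin p}
    {X : Fin n → S → Config d} (hX : IsInterventionalSample P φs blk X) (hn : 0 < n)
    {M : ℝ} (hM : 0 < M) (k : Fin p) (y : Config d) :
    P {ω | M * √n < |cellCount blk (fun h => X h ω) k y - blockSize blk k * pmf (cut k φs) y|} ≤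
      ENNReal.ofReal ((M ^ 2)⁻¹) := by
  classical
  set g : Config d → ℝ := Set.indicator {y} 1 with hg
  have hgm : Measurable g := measurable_one.indicator (MeasurableSet.singleton y)
  set Y : Fin n → S → ℝ := fun h => g ∘ X h with hY
  have hYm : ∀ h, Measurable (Y h) := fun h => hgm.comp (hX.measurable h)
  have hY01 : ∀ h ω, Y h ω ∈ Set.Icc (0 : ℝ) 1 := by
    intro h ω
    by_cases hh : X h ω = y <;> simp [hY, hg, hh]
  have hYL : ∀ h, MemLp (Y h) 2 P := fun h =>
    memLp_of_bounded (ae_of_all _ (hY01 h)) (hYm h).aestronglyMeasurable 2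
  set s := Finset.univ.filter fun h => blk h = k with hs
  have hsum : ∀ ω, (∑ h ∈ s, Y h) ω = cellCount blk (fun h => X h ω) k y := by
    intro ω
    rw [Finset.sum_apply, cellCount, hs, Finset.card_eq_sum_ones, ← Finset.filter_filter,
      Finset.sum_filter (fun h => X h ω = y)]
    push_cast
    refine Finset.sum_congr rfl fun h _ => ?_
    by_cases hh : X h ω = y <;> simp [hY, hg, hh]
  have hmean : ∀ h ∈ s, P[Y h] = pmf (cut k φs) y := by
    intro h hh
    have hb : blk h = k := (Finset.mem_filter.1 hh).2
    have hlaw := hX.law h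
    rw [hb] at hlaw
    have e : Y h = Set.indicator {ω | X h ω = y} 1 := by
      ext ω
      by_cases hh : X h ω = y <;> simp [hY, hg, hh]
    have hmeas : MeasurableSet {ω | X h ω = y} := hX.measurable h (MeasurableSet.singleton y)
    rw [e, integral_indicator_one hmeas, hlaw.measureReal_eq (p := fun z => z = y)
      (MeasurableSet.singleton y), measureReal_def, jointLaw_apply, ENNReal.toReal_ofReal]
    · simp [Finset.filter_eq']
    · exact Finset.sum_nonneg fun _ _ => (pmf_pos _ _).le
  have hmeanS : P[∑ h ∈ s, Y h] = blockSize blk k * pmf (cut k φs) y := by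
    simp only [Finset.sum_apply]
    rw [integral_finsetSum _ fun h _ => (hYL h).integrable (by norm_num),
      Finset.sum_congr rfl hmean, Finset.sum_const, nsmul_eq_mul, blockSize]
  have hvar : variance (∑ h ∈ s, Y h) P ≤ n := by
    rw [IndepFun.variance_sum (fun h _ => hYL h)]
    · calc ∑ h ∈ s, variance (Y h) P ≤ ∑ h ∈ s, (1 : ℝ) := by
            refine Finset.sum_le_sum fun h _ => ?_
            refine (variance_le_sq_of_bounded (ae_of_all _ (hY01 h)) (hYm h).aemeasurable).trans ?_
            norm_num
        _ ≤ n := by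
            rw [Finset.sum_const, nsmul_eq_mul, mul_one]
            exact_mod_cast (Finset.card_le_univ _).trans (by simp)
    · intro h _ h' _ hne
      exact (hX.indep.indepFun hne).comp hgm hgm
  have hn' : (0 : ℝ) < n := by exact_mod_cast hn
  have hcheb := meas_ge_le_variance_div_sq (μ := P)
    (memLp_finsetSum' s fun h _ => hYL h) (c := M * √n) (by positivity)
  rw [hmeanS] at hcheb
  refine (measure_mono fun ω hω => ?_).trans (hcheb.trans (ENNReal.ofReal_le_ofReal ?_))
  · simp only [Set.mem_ofPred_eq, hsum] at hω ⊢
    exact hω.le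
  · rw [mul_pow, Real.sq_sqrt hn'.le, div_le_iff₀ (by positivity)]
    refine hvar.trans (le_of_eq ?_)
    field_simp

/-- With probability close to one the data are accurate. -/
lemma exists_eventually_measure_not_accurate_le {φs : Param d} {S : Type*} [MeasurableSpace S]
    {P : Measure S} [IsProbabilityMeasure P] {blk : ∀ n : ℕ, Fin n → Fin p}
    {X : ∀ n : ℕ, Fin n → S → Config d} (hX : ∀ n, IsInterventionalSample P φs (blk n) (X n))
    {φt : ℕ → S → ∀ j i : Fin p, Group d j i}
    (hφt : ∀ j i, IsBigOp P (fun n ω => ‖φt n ω j i - group φs j i‖) (fun n => (√n)⁻¹))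
    {ε : ℝ} (hε : 0 < ε) :
    ∃ M > 0, ∀ᶠ n : ℕ in atTop,
      P {ω | ¬ Accurate φs M (blk n) (fun h => X n h ω) (φt n ω)} ≤ ENNReal.ofReal ε := by
  set N : ℝ := Fintype.card (Fin p × Config d) + Fintype.card (Fin p × Fin p) + 1
  have hN : 0 < N := by positivity
  set η := ε / N with hη
  have hη0 : 0 < η := by positivity
  choose Ct hCt hCt' using fun q : Fin p × Fin p => hφt q.1 q.2 η hη0
  have hCsum : ∀ q, Ct q ≤ ∑ q, Ct q := fun q =>
    Finset.single_le_sum (fun q _ => (hCt q).le) (Finset.mem_univ q)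
  have hCsum0 : 0 ≤ ∑ q, Ct q := Finset.sum_nonneg fun q _ => (hCt q).le
  -- The first part dominates the constants of all initial estimates; the second makes the Chebyshev
  -- bound at most `η`.
  set M : ℝ := ∑ q, Ct q + (√η)⁻¹
  have hη1 : 0 < √η := Real.sqrt_pos.2 hη0
  have hM : 0 < M := by positivity
  have hMη : (M ^ 2)⁻¹ ≤ η := by
    have h1 : (√η)⁻¹ ≤ M := le_add_of_nonneg_left hCsum0
    calc (M ^ 2)⁻¹ ≤ ((√η)⁻¹ ^ 2)⁻¹ := by gcongr
      _ = η := by rw [inv_pow, inv_inv, Real.sq_sqrt hη0.le]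
  refine ⟨M, hM, ?_⟩
  filter_upwards [eventually_all.2 hCt', eventually_gt_atTop 0] with n hest hn
  have hsub : {ω | ¬ Accurate φs M (blk n) (fun h => X n h ω) (φt n ω)} ⊆
      (⋃ q : Fin p × Config d, {ω | M * √n < |cellCount (blk n) (fun h => X n h ω) q.1 q.2 -
        blockSize (blk n) q.1 * pmf (cut q.1 φs) q.2|}) ∪
      ⋃ q : Fin p × Fin p,
        {ω | Ct q * (√n)⁻¹ < |‖φt n ω q.1 q.2 - group φs q.1 q.2‖|} := by
    intro ω hω
    by_contra hcon
    simp only [Set.mem_union, Set.mem_iUnion, Set.mem_ofPred_eq, not_or, not_exists, not_lt,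
      abs_norm] at hcon
    refine hω ⟨fun k y => hcon.1 (k, y), fun j i => (hcon.2 (j, i)).trans ?_⟩
    have h1 : Ct (j, i) ≤ M := (hCsum (j, i)).trans (le_add_of_nonneg_right (by positivity))
    exact mul_le_mul_of_nonneg_right h1 (by positivity)
  refine (measure_mono hsub).trans ((measure_union_le _ _).trans ?_)
  have h1 : ∀ q : Fin p × Config d, P {ω | M * √n < |cellCount (blk n) (fun h => X n h ω) q.1 q.2 -
      blockSize (blk n) q.1 * pmf (cut q.1 φs) q.2|} ≤ ENNReal.ofReal η := fun q =>
    (measure_cellCount_le (hX n) hn hM q.1 q.2).trans (ENNReal.ofReal_le_ofReal hMη)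
  calc _ ≤ ∑ q : Fin p × Config d, ENNReal.ofReal η + ∑ q : Fin p × Fin p, ENNReal.ofReal η :=
        add_le_add ((measure_iUnion_fintype_le _ _).trans (Finset.sum_le_sum fun q _ => h1 q))
          ((measure_iUnion_fintype_le _ _).trans (Finset.sum_le_sum fun q _ => hest q))
    _ = ENNReal.ofReal ((Fintype.card (Fin p × Config d) + Fintype.card (Fin p × Fin p)) * η) := by
        rw [Finset.sum_const, Finset.sum_const, ← add_nsmul, nsmul_eq_mul,
          ENNReal.ofReal_mul (by positivity)]
        congr 1
        rw [← Nat.cast_add, ENNReal.ofReal_natCast]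
        rfl
    _ ≤ ENNReal.ofReal ε := by
        refine ENNReal.ofReal_le_ofReal ?_
        calc _ ≤ N * η := mul_le_mul_of_nonneg_right (by simp [N]) hη0.le
          _ = ε := by rw [hη]; field_simp

end DiscreteBN

end

/-! ### Selection of a maximizer and conclusion -/

theorem theorem3
    {p : ℕ} (d : Fin p → ℕ)
    -- the true parameter
    (φs : DiscreteBN.Param d) (hφs : φs ∈ DiscreteBN.paramSpace d)
    (hnat : DiscreteBN.Natural φs)
    -- for every sample size n, the data matrix with its blocks
    {S : Type*} [MeasurableSpace S] (P : MeasureTheory.Measure S)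
    [MeasureTheory.IsProbabilityMeasure P]
    (blk : ∀ n : ℕ, Fin n → Fin p) (X : ∀ n : ℕ, Fin n → S → DiscreteBN.Config d)
    (hX : ∀ n, DiscreteBN.IsInterventionalSample P φs (blk n) (X n))
    (α : Fin p → ℝ) (hα : ∀ k, 0 < α k)
    (hblk : ∀ k, Filter.Tendsto (fun n : ℕ => (DiscreteBN.blockSize (blk n) k : ℝ) / (n : ℝ))
      Filter.atTop (nhds (α k)))
    -- the initial estimates of the groups and the adaptive weights
    (γ : ℝ) (hγ : 0 < γ)
    (φt : ℕ → S → ∀ j i : Fin p, DiscreteBN.Group d j i)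
    (hφt : ∀ j i, DiscreteBN.IsBigOp P
      (fun n ω => ‖φt n ω j i - DiscreteBN.group φs j i‖) (fun n => (Real.sqrt n)⁻¹))
    -- the tuning parameters
    (lam : ℕ → ℝ) (hlam : ∀ n, 0 < lam n)
    (hlam_sqrt : Filter.Tendsto (fun n : ℕ => lam n / Real.sqrt n) Filter.atTop (nhds 0))
    (hlam_pow : Filter.Tendsto (fun n : ℕ => lam n * (n : ℝ) ^ ((γ - 1) / 2))
      Filter.atTop Filter.atTop) :
    ∃ φh : ℕ → S → DiscreteBN.Param d,
      Filter.Tendsto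
        (fun n => P {ω | ¬ (φh n ω ∈ DiscreteBN.paramSpace d ∧
          IsMaxOn (DiscreteBN.penLogLik (blk n) (fun h => X n h ω) (lam n)
            (DiscreteBN.adaptiveWeight γ (φt n ω))) (DiscreteBN.paramSpace d) (φh n ω) ∧
          ∀ j i, DiscreteBN.group φs j i = 0 → DiscreteBN.group (φh n ω) j i = 0)})
        Filter.atTop (nhds 0) ∧
      DiscreteBN.IsBigOp P (fun n ω => ‖φh n ω - φs‖) (fun n => (Real.sqrt n)⁻¹) := by

  classical
  let Good : ℕ → S → DiscreteBN.Param d → Prop := fun n ω φ => φ ∈ DiscreteBN.paramSpace d ∧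
    IsMaxOn (DiscreteBN.penLogLik (blk n) (fun h => X n h ω) (lam n)
      (DiscreteBN.adaptiveWeight γ (φt n ω))) (DiscreteBN.paramSpace d) φ
  -- An arbitrary choice, independent of `ε`. It need not be measurable, since every probability
  -- below is bounded by monotonicity of the outer measure.
  let φh : ℕ → S → DiscreteBN.Param d := fun n ω =>
    if h : ∃ φ, Good n ω φ then h.choose else φs
  have hφh : ∀ n ω, (∃ φ, Good n ω φ) → Good n ω (φh n ω) := by
    intro n ω h
    simp only [φh, dif_pos h]
    exact h.choose_spec
  obtain ⟨a, ha, hblk'⟩ : ∃ a > 0, ∀ᶠ n : ℕ in atTop, ∀ k,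
      a * n ≤ (DiscreteBN.blockSize (blk n) k : ℝ) := by
    -- The single row of the sample of size one belongs to some block.
    have hp : Nonempty (Fin p) := ⟨blk 1 0⟩
    obtain ⟨k₀, hk₀⟩ := Finite.exists_min α
    refine ⟨α k₀ / 2, half_pos (hα k₀), ?_⟩
    filter_upwards [eventually_all.2 fun k =>
      (hblk k).eventually_const_le (show α k₀ / 2 < α k by linarith [hk₀ k, hα k₀]),
      eventually_gt_atTop 0] with n hn hn0 k
    have hn0' : (0 : ℝ) < n := by exact_mod_cast hn0
    exact (le_div_iff₀ hn0').1 (hn k)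
  have hlam_le : ∀ᶠ n : ℕ in atTop, lam n ≤ √n := by
    filter_upwards [hlam_sqrt.eventually_le_const one_pos, eventually_gt_atTop 0] with n hn hn0
    have hn0' : (0 : ℝ) < n := by exact_mod_cast hn0
    rwa [div_le_one (Real.sqrt_pos.2 hn0')] at hn
  have key : ∀ ε : ℝ, 0 < ε → ∃ C > 0, ∀ᶠ n : ℕ in atTop, ∃ E : Set S,
      P E ≤ ENNReal.ofReal ε ∧ ∀ ω ∉ E, (φh n ω ∈ DiscreteBN.paramSpace d ∧
          IsMaxOn (DiscreteBN.penLogLik (blk n) (fun h => X n h ω) (lam n)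
            (DiscreteBN.adaptiveWeight γ (φt n ω))) (DiscreteBN.paramSpace d) (φh n ω) ∧
          ∀ j i, DiscreteBN.group φs j i = 0 → DiscreteBN.group (φh n ω) j i = 0) ∧
        ‖φh n ω - φs‖ ≤ C * (√n)⁻¹ := by
    intro ε hε
    obtain ⟨M, hM, hacc⟩ :=
      DiscreteBN.exists_eventually_measure_not_accurate_le hX hφt hε
    obtain ⟨C, hC, hcons⟩ :=
      DiscreteBN.exists_eventually_consistent hφs hnat blk ha hblk' hγ hlam hlam_le hM
    refine ⟨C, hC, ?_⟩
    filter_upwards [hacc, hcons, DiscreteBN.eventually_sparse (φs := φs) blk hγ hlam hlam_pow hM hC]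
      with n hn1 hn2 hn3
    refine ⟨_, hn1, fun ω hω => ?_⟩
    have hω' : DiscreteBN.Accurate φs M (blk n) (fun h => X n h ω) (φt n ω) := by
      simpa using hω
    obtain ⟨⟨φ, hφ, hmax⟩, hfs, hclose⟩ := hn2 _ _ hω'
    obtain ⟨h1, h2⟩ := hφh n ω ⟨φ, hφ, hmax⟩
    have h3 := hclose _ h1 h2
    exact ⟨⟨h1, h2, hn3 _ _ hω' hfs _ h1 h2 h3⟩, h3⟩
  refine ⟨φh, ?_, ?_⟩
  · rw [ENNReal.tendsto_nhds_zero]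
    intro ε hε
    by_cases htop : ε = ∞
    · simp [htop]
    obtain ⟨C, -, h⟩ := key ε.toReal (ENNReal.toReal_pos hε.ne' htop)
    filter_upwards [h] with n ⟨E, hE, hω⟩
    rw [ENNReal.ofReal_toReal htop] at hE
    refine (measure_mono fun ω hbad => ?_).trans hE
    by_contra hωE
    exact hbad (hω ω hωE).1
  · intro ε hε
    obtain ⟨C, hC, h⟩ := key ε hε
    refine ⟨C, hC, ?_⟩
    filter_upwards [h] with n ⟨E, hE, hω⟩
    refine (measure_mono fun ω hbad => ?_).trans hE
    by_contra hωE
    have h1 := (hω ω hωE).2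
    simp only [Set.mem_ofPred_eq, abs_norm] at hbad
    exact absurd h1 (not_le.2 hbad)
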